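/- Let $p$ be an odd prime, let $r$ be a positive integer with $\gcd(r,p)=1$, and suppose that the multiplicative order $s=o_p(r)$ of $r$ modulo $p$ satisfies $s>1$. Let $G$ be the group given by generators $a,b,x,y$ and defining relations $$a^p=b^p=x^s=y^2=1,\quad [a,b]=[x,y]=1,\quad x^{-1}ax=a^r,\quad x^{-1}bx=b^r,\quad y^{-1}ay=b,\quad y^{-1}by=a .$$ Then $G$ has order $2sp^2$. Let $\mathbb{F}_q$ be a finite field with $q$ elements, where $\gcd(q,|G|)=1$. Write $o_n(q)$ for the multiplicative order of $q$ modulo $n$, $o_d=o_d(q)$, $\varphi$ for Euler's function, and put $$f=o_p(q)=o_{2p}(q),\qquad g=\gcd\{d : d\mid s,\ \tfrac{s}{d}\mid f\},$$ and, for $s$ even, $g'=\gcd\{d : d\mid \tfrac{s}{2},\ \tfrac{s}{2d}\text{ is odd and } \tfrac{s}{2d}\mid f\}$. For a ring $R$ let $R^{(k)}$ denote the direct sum of $k$ copies of $R$, and let $M_n(R)$ denote the ring of $n\times n$ matrices over $R$. Then all multiplicities and extension degrees occurring below are integers, and there are the following isomorphisms of $\mathbb{F}_q$-algebras. (i) Let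 $s$ be odd. If $f$ is odd, then $$\mathbb{F}_qG\cong\bigoplus_{d\mid s}\mathbb{F}_{q^{o_d}}^{\left(\frac{2\varphi(d)}{o_d}\right)}\oplus M_s\bigl(\mathbb{F}_{q^{fg/s}}\bigr)^{\left(\frac{2(p-1)}{fg}\right)}\oplus M_{2s}\bigl(\mathbb{F}_{q^{fg/s}}\bigr)^{\left(\frac{p^2-p}{2fg}\right)};$$ if $f$ is even, then $$\mathbb{F}_qG\cong\bigoplus_{d\mid s}\mathbb{F}_{q^{o_d}}^{\left(\frac{2\varphi(d)}{o_d}\right)}\oplus M_s\bigl(\mathbb{F}_{q^{fg/s}}\bigr)^{\left(\frac{2(p-1)}{fg}\right)}\oplus M_{2s}\bigl(\mathbb{F}_{q^{fg/(2s)}}\bigr)^{\left(\frac{p-1}{fg}\right)}\oplus M_{2s}\bigl(\mathbb{F}_{q^{fg/s}}\bigr)^{\left(\frac{(p-1)^2}{2fg}\right)}.$$ (ii) Let $s$ be even. If $f$ is odd, then $$\mathbb{F}_qG\cong\bigoplus_{d\mid s}\mathbb{F}_{q^{o_d}}^{\left(\frac{2\varphi(d)}{o_d}\right)}\oplus M_s\bigl(\mathbb{F}_{q^{fg/s}}\bigr)^{\left(\frac{2(p-1)}{fg}\right)}\oplus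 M_{2s}\bigl(\mathbb{F}_{q^{fg/s}}\bigr)^{\left(\frac{(p-1)^2}{2fg}\right)}\oplus M_s\bigl(\mathbb{F}_{q^{2fg'/s}}\bigr)^{\left(\frac{p-1}{fg'}\right)};$$ if $f$ is even, then $$\mathbb{F}_qG\cong\bigoplus_{d\mid s}\mathbb{F}_{q^{o_d}}^{\left(\frac{2\varphi(d)}{o_d}\right)}\oplus M_s\bigl(\mathbb{F}_{q^{fg/s}}\bigr)^{\left(\frac{4(p-1)}{fg}\right)}\oplus M_{2s}\bigl(\mathbb{F}_{q^{fg/s}}\bigr)^{\left(\frac{(p-1)^2}{2fg}\right)}.$$ -/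

import Mathlib

/-- The four generators `a, b, x, y`. -/
inductive MetaGen : Type
  | a | b | x | y

/-- The defining relators of the group `⟨a, b, x, y⟩`; each relation `u = v` is written as the
word `u * v⁻¹`. -/
def metaRels (p r s : ℕ) : Set (FreeGroup MetaGen) :=
  let a := FreeGroup.of MetaGen.a
  let b := FreeGroup.of MetaGen.b
  let x := FreeGroup.of MetaGen.x
  let y := FreeGroup.of MetaGen.y
  { a ^ p, b ^ p, x ^ s, y ^ 2,
    a⁻¹ * b⁻¹ * a * b,
    x⁻¹ * y⁻¹ * x * y,
    x⁻¹ * a * x * (a ^ r)⁻¹,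
    x⁻¹ * b * x * (b ^ r)⁻¹,
    y⁻¹ * a * y * b⁻¹,
    y⁻¹ * b * y * a⁻¹ }

/-- The group generated by `a, b, x, y` subject to
`a^p = b^p = x^s = y^2 = 1`, `[a,b] = [x,y] = 1`, `x⁻¹ax = a^r`, `x⁻¹bx = b^r`,
`y⁻¹ay = b`, `y⁻¹by = a`. -/
abbrev MetaGroup (p r s : ℕ) : Type := PresentedGroup (metaRels p r s)

/-- `o_n(k)`, the multiplicative order of `k` modulo `n`. -/
noncomputable def ordMod (n k : ℕ) : ℕ := orderOf (k : ZMod n)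

/-- `g = gcd {d ∣ s : (s / d) ∣ f}`. -/
def gPar (s f : ℕ) : ℕ := (s.divisors.filter fun d => s / d ∣ f).gcd id

/-- `g' = gcd {d ∣ s/2 : s/(2d) is odd and s/(2d) ∣ f}`, used for even `s`. -/
def gPar' (s f : ℕ) : ℕ :=
  ((s / 2).divisors.filter fun d => Odd (s / (2 * d)) ∧ s / (2 * d) ∣ f).gcd id

/-- For a finite field `F` with `q` elements and `n ≥ 1`, the extension field of `F` with `q ^ n`
elements: the splitting field of `X ^ (q ^ n) - X` over `F`. -/
noncomputable abbrev ExtField (F : Type*) [Field F] (n : ℕ) : Type _ :=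
  ((Polynomial.X : Polynomial F) ^ (Nat.card F ^ n) - Polynomial.X).SplittingField

/-- `M_n(𝔽_{q^m})^{(k)}`, the direct sum of `k` copies of the algebra of `n × n` matrices over the
field with `q ^ m` elements, where `q` is the cardinality of `F`. -/
abbrev MatSum (F : Type*) [Field F] (n m k : ℕ) : Type _ :=
  Fin k → Matrix (Fin n) (Fin n) (ExtField F m)

/-- `⨁_{d ∣ s} 𝔽_{q^{o_d}}^{(2φ(d)/o_d)}` with `o_d = o_d(q)`, where `q` is the cardinality
of `F`. -/
abbrev CommSum (F : Type*) [Field F] (s q : ℕ) : Type _ :=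
  (d : s.divisors) → Fin (2 * Nat.totient d / ordMod d q) → ExtField F (ordMod d q)

open Module

universe u v

/-! ### Simultaneous eigenvectors -/

/-! Since `q` is prime to `|G|`, the group algebra is semisimple, and every division ring in its
Wedderburn decomposition is a finite field. So it is a product of matrix algebras `M_d(D)`, and
three things are wanted: `d`, the degree `[D : F]`, and how often each shape occurs.

Shapes come from Clifford theory. Extend a factor to an algebraic closure of `D` and let `T` be a
normal subgroup that acts through commuting operators. It has a common eigenvector `w`, with
character `χ`. If `T` contains the stabiliser of `χ` under conjugation, then the translates of `w`
along `G ⧸ T` form a basis, so `d = [G : T]` (`degree_eq_index`). Moreover `[D : F]` divides `k`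
exactly when `χ ^ (q ^ k)` is a `G`-conjugate of `χ` (`finrank_dvd_iff`).

Let `K = ⟨a, b⟩`, the kernel of the projection to `⟨x, y⟩`. A character of `K` is a pair `(α, β)` of
`p`-th roots of unity; `x` raises both to the power `r` and `y` exchanges them. Outside the
commutative factors there are three kinds. If `α = β ≠ 1`, then `T = ⟨y, K⟩` and `d = s`. If `α ≠ β`
and `αβ ≠ 1`, then `T = K` and `d = 2s`. If `β = α⁻¹ ≠ 1`, the answer depends on whether `-1` is a
power of `r`: for even `s` it is, `T = ⟨x ^ (s/2) * y, K⟩` and `d = s`; for odd `s` it is not, `T =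
K` and `d = 2s`. The degree condition is that `q ^ k` is a power of `r` modulo `p`, that is `f ∣ k *
s`, so the degree is `f / gcd(f, s) = fg/s`. Only for `β = α⁻¹` and odd `s` is `q ^ k = -r ^ i`
allowed too, which replaces `s` by `2s`.

Multiplicities come from dimensions. The factors on which a normal subgroup `N` acts trivially have
total dimension `[G : N]` (`sum_finrank_eq_index`). Taking `N` to be `K`, `⟨ab⁻¹⟩`, `⟨ab⟩`, `1` and
`⟨x ^ m, K⟩` isolates each class. All factors of a noncommutative class have one shape, so the
multiplicity is a quotient; the commutative ones are sorted by the order of `x`. -/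

theorem linearIndependent_of_simultaneous_eigenvectors {K V ι κ : Type*} [Field K]
    [AddCommGroup V] [Module K V] (b : ι → V) (T : κ → End K V) (ev : ι → κ → K)
    (hb : ∀ i, b i ≠ 0) (hT : ∀ i t, T t (b i) = ev i t • b i)
    (hev : ∀ i j, i ≠ j → ∃ t, ev i t ≠ ev j t) : LinearIndependent K b := by
  classical
  rw [linearIndependent_iff']
  intro s
  induction s using Finset.induction_on with
  | empty => simp
  | insert i₀ s hi₀ ih =>
    intro c hc
    -- For `t` separating `j` from `i₀`, the operator `T t - ev i₀ t` kills the `i₀` term and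
    -- rescales the others, with a nonzero factor at `j`.
    have hs : ∀ j ∈ s, c j = 0 := by
      intro j hj
      obtain ⟨t, ht⟩ := hev j i₀ (fun h => hi₀ (h ▸ hj))
      have h1 : (T t - ev i₀ t • (LinearMap.id : End K V)) (∑ i ∈ insert i₀ s, c i • b i) = 0 := by
        rw [hc, map_zero]
      rw [Finset.sum_insert hi₀, map_add, map_sum] at h1
      have h2 : (T t - ev i₀ t • (LinearMap.id : End K V)) (c i₀ • b i₀) = 0 := by
        simp [hT]
      have h3 : ∀ i ∈ s, (T t - ev i₀ t • (LinearMap.id : End K V)) (c i • b i)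
          = (c i * (ev i t - ev i₀ t)) • b i := by
        intro i _
        simp [hT, smul_smul, smul_sub, mul_comm (c i), sub_mul, sub_smul]
      rw [h2, zero_add, Finset.sum_congr rfl h3] at h1
      exact (mul_eq_zero.mp (ih _ h1 j hj)).resolve_right (sub_ne_zero.mpr ht)
    intro j hj
    rcases Finset.mem_insert.mp hj with rfl | hj
    · rw [Finset.sum_insert hi₀, Finset.sum_eq_zero (fun i hi => by rw [hs i hi, zero_smul]),
        add_zero] at hc
      exact (smul_eq_zero.mp hc).resolve_right (hb j)
    · exact hs j hj

/-- On a minimal nonzero stable subspace every operator of `S` is a scalar: its eigenspace there is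
stable under everything commuting with it, hence is the whole subspace. -/
theorem exists_simultaneous_eigenvector {K V : Type*} [Field K] [IsAlgClosed K]
    [AddCommGroup V] [Module K V] [FiniteDimensional K V] [Nontrivial V] (S : Set (End K V))
    (hS : ∀ f ∈ S, ∀ g ∈ S, Commute f g) : ∃ w : V, w ≠ 0 ∧ ∀ f ∈ S, ∃ μ : K, f w = μ • w := by
  classical
  let P : Submodule K V → Prop := fun W => W ≠ ⊥ ∧ ∀ f ∈ S, ∀ v ∈ W, f v ∈ W
  obtain ⟨W, hW, hmin⟩ := WellFounded.has_min
    (wellFounded_lt : WellFounded ((· < ·) : Submodule K V → Submodule K V → Prop))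
    {W | P W} ⟨⊤, top_ne_bot, fun _ _ _ _ => Submodule.mem_top⟩
  obtain ⟨w, hw, hw0⟩ := W.exists_mem_ne_zero_of_ne_bot hW.1
  refine ⟨w, hw0, fun f hf => ?_⟩
  have : Nontrivial W := Submodule.nontrivial_iff_ne_bot.mpr hW.1
  obtain ⟨μ, hμ⟩ := Module.End.exists_eigenvalue (f.restrict (hW.2 f hf))
  obtain ⟨u, hu⟩ := hμ.exists_hasEigenvector
  have hfu : f u = μ • (u : V) := by
    have := hu.apply_eq_smul
    simpa using congrArg Subtype.val this
  let W' : Submodule K V := W ⊓ LinearMap.ker (f - μ • LinearMap.id)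
  have hW' : P W' := by
    refine ⟨fun h => hu.2 ?_, fun g hg v hv => ?_⟩
    · have : (u : V) ∈ W' := ⟨u.2, by simp [hfu]⟩
      rw [h] at this
      exact Subtype.ext this
    · refine ⟨hW.2 g hg v hv.1, ?_⟩
      have h1 : f v = μ • v := by simpa [sub_eq_zero] using hv.2
      have h2 : f (g v) = g (f v) := congrArg (fun e : End K V => e v) (hS f hf g hg).eq
      simp [h2, h1]
  have hle : W' = W := by
    by_contra hne
    exact hmin W' hW' (lt_of_le_of_ne inf_le_left hne)
  have : w ∈ W' := hle ▸ hw
  exact ⟨μ, by simpa [sub_eq_zero] using this.2⟩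

/-! ### Finite fields -/

/-- The order of the Frobenius automorphism of `D` over `F` is the degree. Degrees are only ever
accessed through this divisibility criterion. -/
theorem FiniteField.forall_pow_card_pow_eq_iff {F D : Type*} [Field F] [Finite F] [Field D]
    [Algebra F D] [FiniteDimensional F D] (k : ℕ) :
    (∀ c : D, c ^ (Nat.card F ^ k) = c) ↔ finrank F D ∣ k := by
  classical
  have := Fintype.ofFinite F
  have : Finite D := Module.finite_of_finite F
  rw [← FiniteField.orderOf_frobeniusAlgHom F D, orderOf_dvd_iff_pow_eq_one,
    Nat.card_eq_fintype_card]
  have key : ∀ c : D, (FiniteField.frobeniusAlgHom F D ^ k) c = c ^ Fintype.card F ^ k := by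
    intro c
    rw [AlgHom.coe_pow, FiniteField.coe_frobeniusAlgHom, pow_iterate]
  simp only [DFunLike.ext_iff, key, AlgHom.one_apply]

/-- A degree `m` extension of a finite field is its standard degree `m` extension. -/
theorem nonempty_algEquiv_extField {F D : Type*} [Field F] [Finite F] [Field D]
    [Algebra F D] [FiniteDimensional F D] (m : ℕ) (hm : finrank F D = m) :
    Nonempty (D ≃ₐ[F] ExtField F m) := by
  have : Finite D := Module.finite_of_finite F
  have := Fintype.ofFinite D
  have hc : Fintype.card D = Nat.card F ^ m := by
    rw [← Nat.card_eq_fintype_card, Module.natCard_eq_pow_finrank (K := F), hm]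
  have := FiniteField.isSplittingField_sub D F
  rw [hc] at this
  exact ⟨Polynomial.IsSplittingField.algEquiv D _⟩

/-- The Wedderburn decomposition of a semisimple finite group algebra over a finite field. -/
theorem exists_algEquiv_pi_matrix_field (F : Type u) (G : Type v) [Field F] [Finite F]
    [Group G] [Finite G]
    (hG : (Nat.card G : F) ≠ 0) :
    ∃ (n : ℕ) (D : Fin n → Type (max u v)) (d : Fin n → ℕ) (_ : ∀ i, Field (D i))
      (_ : ∀ i, Algebra F (D i)) (_ : ∀ i, FiniteDimensional F (D i)), (∀ i, d i ≠ 0) ∧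
      Nonempty (MonoidAlgebra F G ≃ₐ[F] Π i, Matrix (Fin (d i)) (Fin (d i)) (D i)) := by
  have : NeZero (Nat.card G : F) := ⟨hG⟩
  obtain ⟨n, D, d, _, _, hD, hd, ⟨e⟩⟩ :=
    IsSemisimpleRing.exists_algEquiv_pi_matrix_divisionRing_finite F (MonoidAlgebra F G)
  have : ∀ i, Finite (D i) := fun i => Module.finite_of_finite F
  exact ⟨n, D, d, fun i => littleWedderburn (D i), inferInstance, hD, fun i => (hd i).out, ⟨e⟩⟩

/-! ### Absolutely irreducible representations of a finite group over a finite field -/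

section Clifford

variable {F : Type*} [Field F] {G : Type*} [Group G] {D : Type*} [Field D] [Algebra F D]
  {d : ℕ} (Ω : Type*) [Field Ω] [Algebra F Ω] [Algebra D Ω] [IsScalarTower F D Ω]

/-- The action of a group algebra on `Ω ^ d` given by a matrix representation over a subfield. -/
noncomputable def extAction (ρ : MonoidAlgebra F G →ₐ[F] Matrix (Fin d) (Fin d) D) :
    MonoidAlgebra F G →ₐ[F] End Ω (Fin d → Ω) :=
  ((Matrix.toLinAlgEquiv' (R := Ω) (n := Fin d)).restrictScalars F).toAlgHom.comp
    ((IsScalarTower.toAlgHom F D Ω).mapMatrix.comp ρ)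

/-- The action of the group elements in `extAction`. -/
noncomputable def extGroupAction (ρ : MonoidAlgebra F G →ₐ[F] Matrix (Fin d) (Fin d) D) :
    G →* End Ω (Fin d → Ω) :=
  ((extAction Ω ρ : MonoidAlgebra F G →ₐ[F] End Ω (Fin d → Ω)) :
    MonoidAlgebra F G →* End Ω (Fin d → Ω)).comp (MonoidAlgebra.of F G)

variable {Ω} {ρ : MonoidAlgebra F G →ₐ[F] Matrix (Fin d) (Fin d) D}

theorem extAction_apply (z : MonoidAlgebra F G) (v : Fin d → Ω) :
    extAction Ω ρ z v = ((ρ z).map (algebraMap D Ω)).mulVec v := rfl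

theorem extGroupAction_apply (g : G) (v : Fin d → Ω) :
    extGroupAction Ω ρ g v = ((ρ (MonoidAlgebra.of F G g)).map (algebraMap D Ω)).mulVec v := rfl

theorem extAction_eq_sum [Fintype G] (z : MonoidAlgebra F G) :
    extAction Ω ρ z = ∑ g, z.coeff g • extGroupAction Ω ρ g := by
  conv_lhs => rw [MonoidAlgebra.lift_unique (extAction Ω ρ) z]
  rw [Finsupp.sum_fintype _ _ (by simp)]
  rfl

theorem extGroupAction_eq_one_iff (g : G) :
    extGroupAction Ω ρ g = 1 ↔ ρ (MonoidAlgebra.of F G g) = 1 := by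
  have h1 : extGroupAction Ω ρ g = Matrix.toLinAlgEquiv'
      ((IsScalarTower.toAlgHom F D Ω).mapMatrix (ρ (MonoidAlgebra.of F G g))) := rfl
  constructor
  · intro h
    rw [h1, ← map_one (Matrix.toLinAlgEquiv' (R := Ω) (n := Fin d)),
      (Matrix.toLinAlgEquiv' (R := Ω) (n := Fin d)).injective.eq_iff,
      ← map_one (IsScalarTower.toAlgHom F D Ω).mapMatrix] at h
    exact Matrix.map_injective (algebraMap D Ω).injective h
  · intro h
    rw [h1, h, map_one, map_one]

/-- A nonzero subspace that is stable under a surjective representation is everything. -/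
theorem eq_top_of_stable [Finite G] (hρ : Function.Surjective ρ) (W : Submodule Ω (Fin d → Ω))
    (hW : ∀ g, ∀ v ∈ W, extGroupAction Ω ρ g v ∈ W) {w : Fin d → Ω} (hw : w ∈ W) (hw0 : w ≠ 0) :
    W = ⊤ := by
  classical
  have := Fintype.ofFinite G
  have hz : ∀ z, ∀ v ∈ W, extAction Ω ρ z v ∈ W := by
    intro z v hv
    rw [extAction_eq_sum, LinearMap.sum_apply]
    refine W.sum_mem fun g _ => ?_
    rw [LinearMap.smul_apply, ← algebraMap_smul Ω]
    exact W.smul_mem _ (hW g v hv)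
  obtain ⟨j, hj⟩ := Function.ne_iff.mp hw0
  rw [Pi.zero_apply] at hj
  -- The image contains the matrix units over `D`, and the unit at `(i, j)` sends `w` to `w j` times
  -- the `i`-th basis vector.
  have he : ∀ i, Pi.single i (1 : Ω) ∈ W := by
    intro i
    obtain ⟨z, hz'⟩ := hρ (Matrix.single i j 1)
    have h1 := W.smul_mem (w j)⁻¹ (hz z w hw)
    rw [extAction_apply, hz'] at h1
    convert h1 using 1
    ext k
    simp [Matrix.map_single, Matrix.single_mulVec, Pi.single_apply, Function.update_apply, hj]
  rw [eq_top_iff]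
  intro v _
  rw [pi_eq_sum_univ' v]
  exact W.sum_mem fun i _ => W.smul_mem _ (he i)

/-- If a normal subgroup fixes a nonzero vector then it acts trivially. -/
theorem map_eq_one_of_fixed [Finite G] (hρ : Function.Surjective ρ) (N : Subgroup G) [N.Normal]
    {w : Fin d → Ω} (hw0 : w ≠ 0) (hw : ∀ n ∈ N, extGroupAction Ω ρ n w = w) :
    ∀ n ∈ N, ρ (MonoidAlgebra.of F G n) = 1 := by
  let W : Submodule Ω (Fin d → Ω) :=
    ⨅ n : N, LinearMap.ker (extGroupAction Ω ρ n - (LinearMap.id : End Ω (Fin d → Ω)))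
  have memW : ∀ v, v ∈ W ↔ ∀ n ∈ N, extGroupAction Ω ρ n v = v := by
    intro v
    simp [W, Submodule.mem_iInf, sub_eq_zero]
  -- The fixed space of `N` is `G`-stable because `N` is normal.
  have hW : W = ⊤ := by
    refine eq_top_of_stable hρ W (fun g v hv => ?_) ((memW w).mpr hw) hw0
    rw [memW] at hv ⊢
    intro n hn
    have h1 := hv (g⁻¹ * n * g) (by simpa using ‹N.Normal›.conj_mem n hn g⁻¹)
    conv_rhs => rw [← h1]
    rw [← Module.End.mul_apply, ← Module.End.mul_apply, ← map_mul, ← map_mul]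
    simp [mul_assoc]
  intro n hn
  rw [← extGroupAction_eq_one_iff (Ω := Ω)]
  refine LinearMap.ext fun v => ?_
  have : v ∈ W := hW ▸ Submodule.mem_top
  exact (memW _).mp this n hn

/-- Only the operators of `T` have to commute, not its elements: this permits nonabelian `T` such as
`⟨y, K⟩`. The values of `χ` outside `T` carry no information. -/
theorem exists_eigenvector_of_commute [IsAlgClosed Ω] (hd : d ≠ 0) (T : Subgroup G)
    (hT : ∀ t ∈ T, ∀ t' ∈ T, Commute (ρ (MonoidAlgebra.of F G t)) (ρ (MonoidAlgebra.of F G t'))) :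
    ∃ (w : Fin d → Ω) (χ : G → Ω), w ≠ 0 ∧ ∀ t ∈ T, extGroupAction Ω ρ t w = χ t • w := by
  classical
  have : Nonempty (Fin d) := ⟨⟨0, Nat.pos_of_ne_zero hd⟩⟩
  obtain ⟨w, hw0, hw⟩ := exists_simultaneous_eigenvector (extGroupAction Ω ρ '' (T : Set G)) (by
    rintro _ ⟨t, ht, rfl⟩ _ ⟨t', ht', rfl⟩
    exact (hT t ht t' ht').map (((Matrix.toLinAlgEquiv' (R := Ω) (n := Fin d)).restrictScalars
      F).toAlgHom.comp (IsScalarTower.toAlgHom F D Ω).mapMatrix))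
  have : ∀ t, ∃ μ : Ω, t ∈ T → extGroupAction Ω ρ t w = μ • w := by
    intro t
    by_cases ht : t ∈ T
    · obtain ⟨μ, h⟩ := hw _ ⟨t, ht, rfl⟩
      exact ⟨μ, fun _ => h⟩
    · exact ⟨0, fun h => (ht h).elim⟩
  choose χ hχ using this
  exact ⟨w, χ, hw0, hχ⟩

section Eigenvector

variable {T : Subgroup G} {w : Fin d → Ω} {χ : G → Ω}

theorem eigenvalue_one (hw0 : w ≠ 0) (hw : ∀ t ∈ T, extGroupAction Ω ρ t w = χ t • w) :
    χ 1 = 1 := by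
  have h := hw 1 T.one_mem
  rw [map_one, Module.End.one_apply] at h
  have h2 : (χ 1 - 1) • w = 0 := by rw [sub_smul, one_smul, ← h, sub_self]
  exact sub_eq_zero.mp ((smul_eq_zero.mp h2).resolve_right hw0)

theorem eigenvalue_mul (hw0 : w ≠ 0) (hw : ∀ t ∈ T, extGroupAction Ω ρ t w = χ t • w)
    {t t' : G} (ht : t ∈ T) (ht' : t' ∈ T) : χ (t * t') = χ t * χ t' := by
  have h := hw _ (T.mul_mem ht ht')
  rw [map_mul, Module.End.mul_apply, hw _ ht', map_smul, hw _ ht, smul_smul] at h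
  have h2 : (χ (t * t') - χ t' * χ t) • w = 0 := by rw [sub_smul, ← h, sub_self]
  rw [mul_comm (χ t)]
  exact sub_eq_zero.mp ((smul_eq_zero.mp h2).resolve_right hw0)

theorem eigenvalue_ne_zero (hw0 : w ≠ 0) (hw : ∀ t ∈ T, extGroupAction Ω ρ t w = χ t • w)
    {t : G} (ht : t ∈ T) : χ t ≠ 0 := by
  intro h
  have h1 := eigenvalue_mul hw0 hw ht (T.inv_mem ht)
  rw [mul_inv_cancel, eigenvalue_one hw0 hw, h, zero_mul] at h1
  exact one_ne_zero h1

theorem eigenvalue_pow (hw0 : w ≠ 0) (hw : ∀ t ∈ T, extGroupAction Ω ρ t w = χ t • w)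
    {t : G} (ht : t ∈ T) (n : ℕ) : χ (t ^ n) = χ t ^ n := by
  induction n with
  | zero => simp [eigenvalue_one hw0 hw]
  | succ n ih => rw [pow_succ, pow_succ, eigenvalue_mul hw0 hw (T.pow_mem ht n) ht, ih]

theorem eigenvalue_inv (hw0 : w ≠ 0) (hw : ∀ t ∈ T, extGroupAction Ω ρ t w = χ t • w)
    {t : G} (ht : t ∈ T) : χ t⁻¹ = (χ t)⁻¹ := by
  apply eq_inv_of_mul_eq_one_left
  rw [← eigenvalue_mul hw0 hw (T.inv_mem ht) ht, inv_mul_cancel, eigenvalue_one hw0 hw]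

theorem eigenvalue_eq_of_map_eq (hw0 : w ≠ 0)
    (hw : ∀ t ∈ T, extGroupAction Ω ρ t w = χ t • w) {t t' : G} (ht : t ∈ T) (ht' : t' ∈ T)
    (h : ρ (MonoidAlgebra.of F G t) = ρ (MonoidAlgebra.of F G t')) : χ t = χ t' := by
  have h1 := hw t ht
  rw [extGroupAction_apply, h, ← extGroupAction_apply, hw t' ht'] at h1
  have h2 : (χ t - χ t') • w = 0 := by rw [sub_smul, h1, sub_self]
  exact sub_eq_zero.mp ((smul_eq_zero.mp h2).resolve_right hw0)

theorem extGroupAction_translate [T.Normal]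
    (hw : ∀ t ∈ T, extGroupAction Ω ρ t w = χ t • w) (g : G) {t : G} (ht : t ∈ T) :
    extGroupAction Ω ρ t (extGroupAction Ω ρ g w)
      = χ (g⁻¹ * t * g) • extGroupAction Ω ρ g w := by
  have h1 := hw (g⁻¹ * t * g) (by simpa using ‹T.Normal›.conj_mem t ht g⁻¹)
  rw [← map_smul, ← h1]
  rw [← Module.End.mul_apply, ← Module.End.mul_apply, ← map_mul, ← map_mul]
  simp [mul_assoc]

theorem extGroupAction_ne_zero (hw0 : w ≠ 0) (g : G) : extGroupAction Ω ρ g w ≠ 0 := by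
  intro h
  apply hw0
  have : extGroupAction Ω ρ g⁻¹ (extGroupAction Ω ρ g w) = w := by
    rw [← Module.End.mul_apply, ← map_mul, inv_mul_cancel, map_one, Module.End.one_apply]
  rw [← this, h, map_zero]

theorem extGroupAction_eq_smul_out
    (hw : ∀ t ∈ T, extGroupAction Ω ρ t w = χ t • w) (g : G) :
    extGroupAction Ω ρ g w = χ (((g : G ⧸ T).out)⁻¹ * g) •
      extGroupAction Ω ρ ((g : G ⧸ T).out) w := by
  have h : ((g : G ⧸ T).out)⁻¹ * g ∈ T := QuotientGroup.eq.mp (QuotientGroup.out_eq' _)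
  rw [← map_smul, ← hw _ h, ← Module.End.mul_apply, ← map_mul, mul_inv_cancel_left]

/-- Changing `g` within its coset of `T` only rescales the translate of `w` by `g`, so one
representative per coset already spans a `G`-stable subspace. -/
theorem span_translates_eq_top [Finite G] (hρ : Function.Surjective ρ) (hw0 : w ≠ 0)
    (hw : ∀ t ∈ T, extGroupAction Ω ρ t w = χ t • w) :
    Submodule.span Ω (Set.range fun c : G ⧸ T => extGroupAction Ω ρ c.out w) = ⊤ := by
  have hmem : ∀ g, extGroupAction Ω ρ g w ∈
      Submodule.span Ω (Set.range fun c : G ⧸ T => extGroupAction Ω ρ c.out w) := by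
    intro g
    rw [extGroupAction_eq_smul_out (T := T) hw g]
    exact Submodule.smul_mem _ _ (Submodule.subset_span ⟨_, rfl⟩)
  refine eq_top_of_stable hρ _ (fun g v hv => ?_) (by simpa using hmem 1) hw0
  induction hv using Submodule.span_induction with
  | mem v hv =>
    obtain ⟨c, rfl⟩ := hv
    simp only
    rw [← Module.End.mul_apply, ← map_mul]
    exact hmem _
  | zero => simp
  | add u v _ _ hu hv => rw [map_add]; exact Submodule.add_mem _ hu hv
  | smul a v _ hv => rw [map_smul]; exact Submodule.smul_mem _ _ hv

variable [T.Normal]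

/-- Under `inertia`, distinct cosets of `T` carry distinct conjugates of `χ`, and eigenvectors with
distinct characters are independent. -/
theorem linearIndependent_translates (hw0 : w ≠ 0)
    (hw : ∀ t ∈ T, extGroupAction Ω ρ t w = χ t • w)
    (inertia : ∀ g, (∀ t ∈ T, χ (g⁻¹ * t * g) = χ t) → g ∈ T) :
    LinearIndependent Ω (fun c : G ⧸ T => extGroupAction Ω ρ c.out w) := by
  refine linearIndependent_of_simultaneous_eigenvectors _ (fun t : T => extGroupAction Ω ρ t)
    (fun c t => χ (c.out⁻¹ * t * c.out)) (fun c => extGroupAction_ne_zero hw0 _)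
    (fun c t => extGroupAction_translate hw c.out t.2) (fun c c' hcc => ?_)
  by_contra! hcon
  apply hcc
  rw [← c.out_eq', ← c'.out_eq']
  refine (QuotientGroup.eq.mpr ?_).symm
  refine inertia _ (fun t ht => ?_)
  have h := hcon ⟨c'.out * t * c'.out⁻¹, ‹T.Normal›.conj_mem t ht _⟩
  simp only [mul_assoc, inv_mul_cancel, mul_one, inv_mul_cancel_left] at h
  rw [← h]
  simp [mul_assoc]

/-- The translates of an eigenvector of `T` form a basis when the inertia group is `T`. -/
noncomputable def translatesBasis [Finite G] (hρ : Function.Surjective ρ) (hw0 : w ≠ 0)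
    (hw : ∀ t ∈ T, extGroupAction Ω ρ t w = χ t • w)
    (inertia : ∀ g, (∀ t ∈ T, χ (g⁻¹ * t * g) = χ t) → g ∈ T) : Basis (G ⧸ T) Ω (Fin d → Ω) :=
  Basis.mk (linearIndependent_translates hw0 hw inertia) (span_translates_eq_top hρ hw0 hw).ge

/-- The degree of a representation induced from `T` is the index of `T`. -/
theorem degree_eq_index [Finite G] (hρ : Function.Surjective ρ) (hw0 : w ≠ 0)
    (hw : ∀ t ∈ T, extGroupAction Ω ρ t w = χ t • w)
    (inertia : ∀ g, (∀ t ∈ T, χ (g⁻¹ * t * g) = χ t) → g ∈ T) : d = T.index := by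
  have h := Module.finrank_eq_nat_card_basis (translatesBasis hρ hw0 hw inertia)
  rw [Module.finrank_fin_fun] at h
  exact h

/-- This reads off the diagonal coefficient of `z` at the translate of `w` by `g`. Elements outside
`T` move that line to the line of another coset, so only the `T`-part of `z` contributes. The left
side does not depend on `g`, which lets conjugates of `χ` be compared. -/
theorem scalar_eq_sum [Finite G] (hρ : Function.Surjective ρ) (hw0 : w ≠ 0)
    (hw : ∀ t ∈ T, extGroupAction Ω ρ t w = χ t • w)
    (inertia : ∀ g, (∀ t ∈ T, χ (g⁻¹ * t * g) = χ t) → g ∈ T)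
    {z : MonoidAlgebra F G} {c : D} (hz : ρ z = Matrix.scalar (Fin d) c) (g : G) :
    algebraMap D Ω c = ∑ᶠ t : T, z.coeff (t : G) • χ (g⁻¹ * t * g) := by
  classical
  have := Fintype.ofFinite G
  let B := translatesBasis hρ hw0 hw inertia
  have hB : ∀ c, B c = extGroupAction Ω ρ c.out w := fun c => Basis.mk_apply _ _ c
  let ℓ := B.coord (g : G ⧸ T)
  have hℓ : ∀ h : G, ℓ (extGroupAction Ω ρ (h * g) w)
      = (if h ∈ T then χ (g⁻¹ * h * g) else 0) * ℓ (extGroupAction Ω ρ g w) := by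
    intro h
    split_ifs with hh
    · rw [map_mul, Module.End.mul_apply, extGroupAction_translate hw g hh, map_smul, smul_eq_mul]
    · rw [extGroupAction_eq_smul_out (T := T) hw (h * g), ← hB, map_smul, zero_mul,
        Basis.coord_apply, Basis.repr_self, Finsupp.single_eq_of_ne, smul_zero]
      intro hc
      apply hh
      have := QuotientGroup.eq.mp hc
      have h2 := ‹T.Normal›.conj_mem _ this g
      simpa [mul_assoc] using h2
  have hℓ0 : ℓ (extGroupAction Ω ρ g w) ≠ 0 := by
    rw [extGroupAction_eq_smul_out (T := T) hw g, ← hB, map_smul, Basis.coord_apply,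
      Basis.repr_self, Finsupp.single_eq_same, smul_eq_mul, mul_one]
    exact eigenvalue_ne_zero hw0 hw (QuotientGroup.eq.mp (QuotientGroup.out_eq' _))
  have h1 : extAction Ω ρ z (extGroupAction Ω ρ g w)
      = algebraMap D Ω c • extGroupAction Ω ρ g w := by
    rw [extAction_apply, hz]
    ext i
    simp [Matrix.mulVec_diagonal, Matrix.scalar_apply, Matrix.diagonal_map]
  have h2 := congrArg ℓ h1
  rw [extAction_eq_sum, LinearMap.sum_apply, map_sum, map_smul, smul_eq_mul] at h2
  apply mul_right_cancel₀ hℓ0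
  rw [← h2, finsum_eq_sum_of_fintype, Finset.sum_mul]
  have h3 : ∀ h : G, ℓ ((z.coeff h • extGroupAction Ω ρ h) (extGroupAction Ω ρ g w))
      = if h ∈ T then z.coeff h • χ (g⁻¹ * h * g) * ℓ (extGroupAction Ω ρ g w) else 0 := by
    intro h
    rw [LinearMap.smul_apply, ← algebraMap_smul Ω, map_smul, ← Module.End.mul_apply, ← map_mul, hℓ]
    split_ifs
    · rw [smul_eq_mul, Algebra.smul_def, mul_assoc (algebraMap F Ω _)]
    · simp
  rw [Finset.sum_congr rfl fun h _ => h3 h, ← Finset.sum_filter]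
  rw [Finset.sum_subtype (p := fun h => h ∈ T) _ (by simp)]

/-- The degree over `F` of the centre of the image of a representation induced from `T`. -/
theorem finrank_dvd_iff [Finite F] [FiniteDimensional F D] [Finite G]
    (hρ : Function.Surjective ρ) (hw0 : w ≠ 0)
    (hw : ∀ t ∈ T, extGroupAction Ω ρ t w = χ t • w)
    (inertia : ∀ g, (∀ t ∈ T, χ (g⁻¹ * t * g) = χ t) → g ∈ T) (k : ℕ) :
    finrank F D ∣ k ↔ ∃ g, ∀ t ∈ T, χ t ^ (Nat.card F ^ k) = χ (g⁻¹ * t * g) := by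
  classical
  have := Fintype.ofFinite F
  have := Fintype.ofFinite G
  let φ : Ω →ₐ[F] Ω := FiniteField.frobeniusAlgHom F Ω ^ k
  have hφ : ∀ c, φ c = c ^ Nat.card F ^ k := by
    intro c
    rw [AlgHom.coe_pow, FiniteField.coe_frobeniusAlgHom, pow_iterate, Nat.card_eq_fintype_card]
  rw [← FiniteField.forall_pow_card_pow_eq_iff]
  constructor
  · intro h
    let B := translatesBasis hρ hw0 hw inertia
    have hB : ∀ c, B c = extGroupAction Ω ρ c.out w := fun c => Basis.mk_apply _ _ c
    -- A Frobenius power fixing `D` commutes with matrices over `D`, so `w'` is an eigenvector with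
    -- character `φ ∘ χ`. A nonzero coordinate of `w'` in the basis of translates identifies that
    -- character with a conjugate of `χ`.
    let w' : Fin d → Ω := fun i => φ (w i)
    have hw' : ∀ t ∈ T, extGroupAction Ω ρ t w' = φ (χ t) • w' := by
      intro t ht
      ext i
      have h1 := congrArg φ (congrFun (hw t ht) i)
      rw [Pi.smul_apply, smul_eq_mul, map_mul] at h1
      rw [Pi.smul_apply, smul_eq_mul, ← h1, extGroupAction_apply, extGroupAction_apply]
      simp only [Matrix.mulVec, dotProduct, map_sum, map_mul, Matrix.map_apply]
      refine Finset.sum_congr rfl fun j _ => ?_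
      rw [hφ (algebraMap D Ω _), ← map_pow, h]
    have hw'0 : w' ≠ 0 := by
      obtain ⟨j, hj⟩ := Function.ne_iff.mp hw0
      exact Function.ne_iff.mpr ⟨j, (map_ne_zero φ).mpr hj⟩
    have : ∃ c, B.repr w' c ≠ 0 := by
      by_contra! hcon
      apply hw'0
      apply B.repr.injective
      ext c
      simpa using hcon c
    obtain ⟨c, hc⟩ := this
    refine ⟨c.out, fun t ht => ?_⟩
    have h1 := congrArg (fun v => B.repr v c) (hw' t ht)
    have h2 : B.repr (extGroupAction Ω ρ t w') c = χ (c.out⁻¹ * t * c.out) * B.repr w' c := by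
      conv_lhs => rw [← B.sum_repr w']
      simp only [map_sum, map_smul, hB, extGroupAction_translate hw _ ht]
      simp only [← hB, Finsupp.coe_finsetSum, Finset.sum_apply, Finsupp.smul_apply,
        Basis.repr_self, Finsupp.single_apply, smul_eq_mul, mul_ite, mul_one, mul_zero]
      rw [Finset.sum_ite_eq' Finset.univ c]
      simp [mul_comm]
    simp only [h2, map_smul, Finsupp.smul_apply, smul_eq_mul] at h1
    rw [← hφ]
    exact (mul_right_cancel₀ hc h1).symm
  -- Conversely, lift the scalar `c` to `z`. Frobenius fixes the coefficients of `z`, so it turns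
  -- the formula for `c` at `1` into the formula for `c` at `g`.
  · rintro ⟨g, hg⟩ c
    obtain ⟨z, hz⟩ := hρ (Matrix.scalar (Fin d) c)
    apply (algebraMap D Ω).injective
    have h1 := scalar_eq_sum hρ hw0 hw inertia hz 1
    have hg1 := scalar_eq_sum hρ hw0 hw inertia hz g
    rw [finsum_eq_sum_of_fintype] at h1 hg1
    rw [map_pow, ← hφ]
    conv_rhs => rw [hg1]
    rw [h1, map_sum]
    refine Finset.sum_congr rfl fun t _ => ?_
    rw [map_smul, hφ, inv_one, one_mul, mul_one, hg t t.2]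

end Eigenvector

end Clifford

/-! ### The part of a group algebra on which a normal subgroup acts trivially -/

/-- Used to see that an averaging idempotent acts as `0` or `1` on each simple factor. -/
theorem IsSimpleRing.eq_zero_or_one_of_isIdempotentElem_of_central {R : Type*} [Ring R]
    [IsSimpleRing R] {c : R} (hc : IsIdempotentElem c) (hcen : ∀ r, r * c = c * r) :
    c = 0 ∨ c = 1 := by
  have hmem : c ∈ Subring.center R := Subring.mem_center_iff.mpr hcen
  let _ := (IsSimpleRing.isField_center R).toField
  let c' : Subring.center R := ⟨c, hmem⟩
  have h : c' * (c' - 1) = 0 := by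
    apply Subtype.ext
    simp [c', mul_sub, hc.eq]
  rcases mul_eq_zero.mp h with h | h
  · exact Or.inl (congrArg Subtype.val h)
  · exact Or.inr (congrArg Subtype.val (sub_eq_zero.mp h))

section Average

variable (F : Type*) [Field F] {G : Type*} [Group G] (N : Subgroup G)

/-- The averaging idempotent of a finite subgroup. -/
noncomputable def averageIdem : MonoidAlgebra F G :=
  (Nat.card N : F)⁻¹ • ∑ᶠ n : N, MonoidAlgebra.of F G n

variable {F N} [Finite G]

theorem of_mul_averageIdem {n : G} (hn : n ∈ N) :
    MonoidAlgebra.of F G n * averageIdem F N = averageIdem F N := by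
  have := Fintype.ofFinite N
  rw [averageIdem, mul_smul_comm, finsum_eq_sum_of_fintype, Finset.mul_sum]
  congr 1
  refine Fintype.sum_equiv (Equiv.mulLeft (⟨n, hn⟩ : N)) _ _ fun x => ?_
  simp

theorem of_mul_averageIdem_comm [N.Normal] (g : G) :
    MonoidAlgebra.of F G g * averageIdem F N = averageIdem F N * MonoidAlgebra.of F G g := by
  have := Fintype.ofFinite N
  rw [averageIdem, mul_smul_comm, smul_mul_assoc, finsum_eq_sum_of_fintype, Finset.mul_sum,
    Finset.sum_mul]
  congr 1
  refine Fintype.sum_equiv (MulAut.conjNormal g : MulAut N).toEquiv _ _ fun x => ?_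
  simp

theorem mul_averageIdem_comm [N.Normal] (z : MonoidAlgebra F G) :
    z * averageIdem F N = averageIdem F N * z := by
  induction z using MonoidAlgebra.induction_on with
  | of g => exact of_mul_averageIdem_comm g
  | add x y hx hy => rw [add_mul, mul_add, hx, hy]
  | smul r x hx => rw [smul_mul_assoc, mul_smul_comm, hx]

theorem map_averageIdem_of_trivial {R : Type*} [Ring R] [Algebra F R]
    (hN : (Nat.card N : F) ≠ 0) (φ : MonoidAlgebra F G →ₐ[F] R)
    (h : ∀ n ∈ N, φ (MonoidAlgebra.of F G n) = 1) : φ (averageIdem F N) = 1 := by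
  have := Fintype.ofFinite N
  rw [averageIdem, map_smul, finsum_eq_sum_of_fintype, map_sum,
    Finset.sum_congr rfl fun (n : N) _ => h n n.2, Finset.sum_const, Finset.card_univ,
    ← Nat.card_eq_fintype_card, ← Nat.cast_smul_eq_nsmul F, smul_smul, inv_mul_cancel₀ hN, one_smul]

theorem isIdempotentElem_averageIdem (hN : (Nat.card N : F) ≠ 0) :
    IsIdempotentElem (averageIdem F N) := by
  have := Fintype.ofFinite N
  have h : ∑ᶠ n : N, MonoidAlgebra.of F G n = (Nat.card N : F) • averageIdem F N := by
    rw [averageIdem, smul_smul, mul_inv_cancel₀ hN, one_smul]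
  change averageIdem F N * averageIdem F N = averageIdem F N
  conv_lhs => enter [1]; rw [averageIdem]
  rw [smul_mul_assoc, finsum_eq_sum_of_fintype, Finset.sum_mul,
    Finset.sum_congr rfl fun n _ => of_mul_averageIdem n.2, Finset.sum_const, Finset.card_univ,
    ← Nat.card_eq_fintype_card, ← Nat.cast_smul_eq_nsmul F, smul_smul, inv_mul_cancel₀ hN, one_smul]

/-- Sending a coset `gN` to `g * averageIdem F N` is a well-defined linear map `σ` on the algebra of
the quotient, and `σ ∘ π` is multiplication by the idempotent. -/
theorem mapDomain_mk_eq_zero_iff [N.Normal] (hN : (Nat.card N : F) ≠ 0) (z : MonoidAlgebra F G) :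
    MonoidAlgebra.mapDomainAlgHom F F (QuotientGroup.mk' N) z = 0 ↔ z * averageIdem F N = 0 := by
  let π := MonoidAlgebra.mapDomainAlgHom F F (QuotientGroup.mk' N)
  have hπ : ∀ g : G, π (MonoidAlgebra.of F G g) = MonoidAlgebra.of F _ (g : G ⧸ N) := by
    intro g
    simp [π]
  constructor
  · intro h
    let σ : MonoidAlgebra F (G ⧸ N) →ₗ[F] MonoidAlgebra F G :=
      (Finsupp.linearCombination F
        (fun c : G ⧸ N => MonoidAlgebra.of F G c.out * averageIdem F N)).comp
        (MonoidAlgebra.coeffLinearEquiv F).toLinearMap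
    have hσ : ∀ g : G, σ (MonoidAlgebra.of F _ (g : G ⧸ N))
        = MonoidAlgebra.of F G g * averageIdem F N := by
      intro g
      have h1 : ((g : G ⧸ N).out)⁻¹ * g ∈ N := QuotientGroup.eq.mp (QuotientGroup.out_eq' _)
      have h2 : σ (MonoidAlgebra.of F _ (g : G ⧸ N))
          = MonoidAlgebra.of F G (g : G ⧸ N).out * averageIdem F N := by
        simp [σ]
      rw [h2, ← of_mul_averageIdem h1, ← mul_assoc, ← map_mul, mul_inv_cancel_left]
      simp only [of_mul_averageIdem h1]
    have key : ∀ z, σ (π z) = z * averageIdem F N := by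
      intro z
      induction z using MonoidAlgebra.induction_on with
      | of g => rw [hπ, hσ]
      | add x y hx hy => rw [add_mul, map_add, map_add, hx, hy]
      | smul r x hx => rw [smul_mul_assoc, map_smul, map_smul, hx]
    rw [← key, show π z = 0 from h, map_zero]
  · intro h
    have h1 := congrArg π h
    rw [map_mul, map_zero, map_averageIdem_of_trivial hN π, mul_one] at h1
    · exact h1
    · intro n hn
      rw [hπ, (QuotientGroup.eq_one_iff n).mpr hn, map_one]

/-- In the decomposition of a group algebra into simple factors, the factors on which a normal
subgroup acts trivially have total dimension the index of this subgroup. -/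
theorem sum_finrank_eq_index [N.Normal] (hN : (Nat.card N : F) ≠ 0) {ι : Type*} [Fintype ι]
    {M : ι → Type*} [∀ i, Ring (M i)] [∀ i, Algebra F (M i)] [∀ i, IsSimpleRing (M i)]
    [∀ i, FiniteDimensional F (M i)] (e : MonoidAlgebra F G ≃ₐ[F] Π i, M i)
    (P : ι → Prop) [DecidablePred P] (hP : ∀ i, P i ↔ ∀ n ∈ N, e (MonoidAlgebra.of F G n) i = 1) :
    ∑ i with P i, finrank F (M i) = N.index := by
  classical
  let ρ : ∀ i, MonoidAlgebra F G →ₐ[F] M i := fun i => (Pi.evalAlgHom F M i).comp e.toAlgHom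
  have hρ : ∀ i, Function.Surjective (ρ i) := fun i =>
    (Function.surjective_eval i).comp e.surjective
  have h1 : ∀ i, P i → ρ i (averageIdem F N) = 1 := fun i hi =>
    map_averageIdem_of_trivial hN (ρ i) ((hP i).mp hi)
  have h0 : ∀ i, ¬ P i → ρ i (averageIdem F N) = 0 := by
    intro i hi
    refine (IsSimpleRing.eq_zero_or_one_of_isIdempotentElem_of_central
      ((isIdempotentElem_averageIdem hN).map (ρ i)) fun r => ?_).resolve_right fun h => hi ?_
    · obtain ⟨z, rfl⟩ := hρ i r
      rw [← map_mul, ← map_mul, mul_averageIdem_comm]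
    · rw [hP]
      intro n hn
      change ρ i _ = 1
      rw [← mul_one (ρ i _), ← h, ← map_mul, of_mul_averageIdem hn]
  let ψ : MonoidAlgebra F G →ₗ[F] Π i : {i // P i}, M i := LinearMap.pi fun i => (ρ i).toLinearMap
  let π := (MonoidAlgebra.mapDomainAlgHom F F (QuotientGroup.mk' N)).toLinearMap
  -- Both kernels are the annihilator of the averaging idempotent. As `ψ` and `π` are onto, their
  -- targets have the same dimension.
  have hker : LinearMap.ker ψ = LinearMap.ker π := by
    ext z
    rw [LinearMap.mem_ker, LinearMap.mem_ker]
    change _ ↔ MonoidAlgebra.mapDomainAlgHom F F (QuotientGroup.mk' N) z = 0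
    rw [mapDomain_mk_eq_zero_iff hN]
    constructor
    · intro h
      apply e.injective
      rw [map_zero]
      funext i
      change ρ i (z * averageIdem F N) = 0
      rw [map_mul]
      by_cases hi : P i
      · rw [show ρ i z = 0 from congrFun h ⟨i, hi⟩, zero_mul]
      · rw [h0 i hi, mul_zero]
    · intro h
      funext i
      have := congrArg (ρ i) h
      rw [map_mul, h1 i i.2, mul_one, map_zero] at this
      exact this
  have hψ : Function.Surjective ψ := by
    intro y
    refine ⟨e.symm fun i => if hi : P i then y ⟨i, hi⟩ else 0, ?_⟩
    funext i
    change e (e.symm _) i = y i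
    rw [e.apply_symm_apply, dif_pos i.2]
  have hπ : Function.Surjective π := by
    intro y
    induction y using MonoidAlgebra.induction_on with
    | of g =>
      obtain ⟨g, rfl⟩ := QuotientGroup.mk_surjective g
      exact ⟨MonoidAlgebra.of F G g, by simp [π]⟩
    | add x y hx hy =>
      obtain ⟨x', rfl⟩ := hx
      obtain ⟨y', rfl⟩ := hy
      exact ⟨x' + y', map_add _ _ _⟩
    | smul r x hx =>
      obtain ⟨x', rfl⟩ := hx
      exact ⟨r • x', map_smul _ _ _⟩
  have e1 := LinearMap.finrank_range_add_finrank_ker ψ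
  have e2 := LinearMap.finrank_range_add_finrank_ker π
  rw [LinearMap.range_eq_top.mpr hψ, finrank_top, hker] at e1
  rw [LinearMap.range_eq_top.mpr hπ, finrank_top] at e2
  have e3 : finrank F (Π i : {i // P i}, M i) = finrank F (MonoidAlgebra F (G ⧸ N)) := by omega
  have := Fintype.ofFinite (G ⧸ N)
  rw [Module.finrank_pi_fintype] at e3
  rw [Finset.sum_subtype (p := P) _ (by simp), e3,
    (MonoidAlgebra.coeffLinearEquiv F).finrank_eq, Module.finrank_finsupp_self]
  rw [← Nat.card_eq_fintype_card]
  rfl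

end Average

/-! ### The group -/

/-- The relations of `MetaGroup`, together with the projection to the group generated by `x, y`
and the independence of `a` and `b`. -/
structure MetaPres {G : Type*} [Group G] (p r s : ℕ)
    (π : G →* Multiplicative (ZMod s) × Multiplicative (ZMod 2)) (a b x y : G) : Prop where
  prime : p.Prime
  s_pos : 0 < s
  a_pow : a ^ p = 1
  b_pow : b ^ p = 1
  x_pow : x ^ s = 1
  y_pow : y ^ 2 = 1
  comm_ab : Commute a b
  comm_xy : Commute x y
  conj_x_a : x⁻¹ * a * x = a ^ r
  conj_x_b : x⁻¹ * b * x = b ^ r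
  conj_y_a : y⁻¹ * a * y = b
  conj_y_b : y⁻¹ * b * y = a
  map_a : π a = 1
  map_b : π b = 1
  map_x : π x = (Multiplicative.ofAdd 1, 1)
  map_y : π y = (1, Multiplicative.ofAdd 1)
  closure_eq_top : Subgroup.closure {a, b, x, y} = ⊤
  indep : ∀ m n : ℤ, a ^ m * b ^ n = 1 → (p : ℤ) ∣ m ∧ (p : ℤ) ∣ n

namespace MetaPres

variable {G : Type*} [Group G] {p r s : ℕ}
  {π : G →* Multiplicative (ZMod s) × Multiplicative (ZMod 2)} {a b x y : G}

theorem map_pow_mul_pow (h : MetaPres p r s π a b x y) (i j : ℕ) :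
    π (x ^ i * y ^ j) = (Multiplicative.ofAdd (i : ZMod s), Multiplicative.ofAdd (j : ZMod 2)) := by
  rw [map_mul, map_pow, map_pow, h.map_x, h.map_y]
  ext <;> simp [← ofAdd_nsmul]

theorem surjective (h : MetaPres p r s π a b x y) : Function.Surjective π := by
  have : NeZero s := ⟨h.s_pos.ne'⟩
  rintro ⟨u, v⟩
  refine ⟨x ^ (Multiplicative.toAdd u).val * y ^ (Multiplicative.toAdd v).val, ?_⟩
  rw [h.map_pow_mul_pow, ZMod.natCast_zmod_val, ZMod.natCast_zmod_val]
  rfl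

theorem closure_le_ker (h : MetaPres p r s π a b x y) : Subgroup.closure {a, b} ≤ π.ker := by
  rw [Subgroup.closure_le]
  rintro _ (rfl | rfl)
  · exact h.map_a
  · exact h.map_b

theorem conj_x_mem (h : MetaPres p r s π a b x y) {k : G} (hk : k ∈ Subgroup.closure {a, b}) :
    x⁻¹ * k * x ∈ Subgroup.closure {a, b} := by
  have : Subgroup.closure {a, b} ≤
      (Subgroup.closure {a, b}).comap (MulAut.conj x⁻¹).toMonoidHom := by
    rw [Subgroup.closure_le]
    rintro _ (rfl | rfl)
    · simpa [h.conj_x_a] using Subgroup.pow_mem _ (Subgroup.subset_closure (by simp)) r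
    · simpa [h.conj_x_b] using Subgroup.pow_mem _ (Subgroup.subset_closure (by simp)) r
  simpa using this hk

theorem conj_y_mem (h : MetaPres p r s π a b x y) {k : G} (hk : k ∈ Subgroup.closure {a, b}) :
    y⁻¹ * k * y ∈ Subgroup.closure {a, b} := by
  have : Subgroup.closure {a, b} ≤
      (Subgroup.closure {a, b}).comap (MulAut.conj y⁻¹).toMonoidHom := by
    rw [Subgroup.closure_le]
    rintro _ (rfl | rfl)
    · simpa [h.conj_y_a] using Subgroup.subset_closure (by simp)
    · simpa [h.conj_y_b] using Subgroup.subset_closure (by simp)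
  simpa using this hk

/-- Both `x` and `y` can be moved left past `⟨a, b⟩`, which they conjugate into itself; their
inverses are positive powers because their orders are finite. -/
theorem exists_eq_pow_mul_pow_mul (h : MetaPres p r s π a b x y) (g : G) :
    ∃ i j : ℕ, ∃ k ∈ Subgroup.closure {a, b}, g = x ^ i * y ^ j * k := by
  have hg : g ∈ Subgroup.closure {a, b, x, y} := h.closure_eq_top ▸ Subgroup.mem_top g
  have hx : ∀ n i j : ℕ, ∀ k ∈ Subgroup.closure {a, b},
      ∃ i' j' : ℕ, ∃ k' ∈ Subgroup.closure {a, b},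
        x ^ i * y ^ j * k * x ^ n = x ^ i' * y ^ j' * k' := by
    intro n
    induction n with
    | zero => exact fun i j k hk => ⟨i, j, k, hk, by simp⟩
    | succ n ih =>
      intro i j k hk
      obtain ⟨i', j', k', hk', e⟩ := ih i j k hk
      refine ⟨i' + 1, j', x⁻¹ * k' * x, h.conj_x_mem hk', ?_⟩
      rw [pow_succ x n, ← mul_assoc, e, pow_succ, mul_assoc (x ^ i') x,
        (h.comm_xy.pow_right j').eq]
      group
  have hy : ∀ n i j : ℕ, ∀ k ∈ Subgroup.closure {a, b},
      ∃ i' j' : ℕ, ∃ k' ∈ Subgroup.closure {a, b},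
        x ^ i * y ^ j * k * y ^ n = x ^ i' * y ^ j' * k' := by
    intro n
    induction n with
    | zero => exact fun i j k hk => ⟨i, j, k, hk, by simp⟩
    | succ n ih =>
      intro i j k hk
      obtain ⟨i', j', k', hk', e⟩ := ih i j k hk
      refine ⟨i', j' + 1, y⁻¹ * k' * y, h.conj_y_mem hk', ?_⟩
      rw [pow_succ y n, ← mul_assoc, e, pow_succ]
      group
  have hxinv : x⁻¹ = x ^ (s - 1) := by
    rw [inv_eq_iff_mul_eq_one, ← pow_succ', Nat.sub_add_cancel h.s_pos, h.x_pow]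
  have hyinv : y⁻¹ = y ^ 1 := by
    rw [inv_eq_iff_mul_eq_one, ← pow_succ', h.y_pow]
  induction hg using Subgroup.closure_induction_right with
  | one => exact ⟨0, 0, 1, Subgroup.one_mem _, by simp⟩
  | mul_right g _ t ht ih =>
    obtain ⟨i, j, k, hk, rfl⟩ := ih
    rcases ht with rfl | rfl | rfl | rfl
    · exact ⟨i, j, _, Subgroup.mul_mem _ hk (Subgroup.subset_closure (by simp)), mul_assoc _ _ _⟩
    · exact ⟨i, j, _, Subgroup.mul_mem _ hk (Subgroup.subset_closure (by simp)), mul_assoc _ _ _⟩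
    · simpa using hx 1 i j k hk
    · simpa using hy 1 i j k hk
  | mul_inv_cancel g _ t ht ih =>
    obtain ⟨i, j, k, hk, rfl⟩ := ih
    rcases ht with rfl | rfl | rfl | rfl
    · exact ⟨i, j, _, Subgroup.mul_mem _ hk (Subgroup.inv_mem _ (Subgroup.subset_closure
        (by simp))), mul_assoc _ _ _⟩
    · exact ⟨i, j, _, Subgroup.mul_mem _ hk (Subgroup.inv_mem _ (Subgroup.subset_closure
        (by simp))), mul_assoc _ _ _⟩
    · rw [hxinv]; exact hx _ i j k hk
    · rw [hyinv]; exact hy _ i j k hk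

theorem ker_eq_closure (h : MetaPres p r s π a b x y) : π.ker = Subgroup.closure {a, b} := by
  refine le_antisymm (fun g hg => ?_) h.closure_le_ker
  obtain ⟨i, j, k, hk, rfl⟩ := h.exists_eq_pow_mul_pow_mul g
  have h1 : π (x ^ i * y ^ j) = 1 := by
    rw [MonoidHom.mem_ker, map_mul, h.closure_le_ker hk, mul_one] at hg
    exact hg
  rw [h.map_pow_mul_pow, Prod.mk_eq_one, ofAdd_eq_one, ofAdd_eq_one,
    ZMod.natCast_eq_zero_iff, ZMod.natCast_eq_zero_iff] at h1
  obtain ⟨⟨i', rfl⟩, ⟨j', rfl⟩⟩ := h1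
  rwa [pow_mul, pow_mul, h.x_pow, h.y_pow, one_pow, one_pow, one_mul, one_mul]

theorem exists_eq_zpow_mul_zpow (h : MetaPres p r s π a b x y) {k : G} (hk : k ∈ π.ker) :
    ∃ m n : ℤ, k = a ^ m * b ^ n := by
  rw [h.ker_eq_closure] at hk
  induction hk using Subgroup.closure_induction with
  | mem g hg =>
    rcases hg with rfl | rfl
    · exact ⟨1, 0, by simp⟩
    · exact ⟨0, 1, by simp⟩
  | one => exact ⟨0, 0, by simp⟩
  | mul g g' _ _ ih ih' =>
    obtain ⟨m, n, rfl⟩ := ih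
    obtain ⟨m', n', rfl⟩ := ih'
    refine ⟨m + m', n + n', ?_⟩
    rw [zpow_add, zpow_add, mul_assoc, mul_assoc, ← mul_assoc (b ^ n),
      ((h.comm_ab.zpow_zpow m' n).eq).symm, mul_assoc]
  | inv g _ ih =>
    obtain ⟨m, n, rfl⟩ := ih
    refine ⟨-m, -n, ?_⟩
    rw [mul_inv_rev, zpow_neg, zpow_neg, ← zpow_neg, ← zpow_neg,
      (h.comm_ab.zpow_zpow (-m) (-n)).eq]

/-- The relations bound the order from above; `indep` gives the lower bound. -/
theorem card_ker (h : MetaPres p r s π a b x y) : Nat.card π.ker = p ^ 2 := by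
  have : NeZero p := ⟨h.prime.ne_zero⟩
  have hval : ∀ (t : G), t ^ p = 1 → ∀ m : ℤ, t ^ ((m : ZMod p).val) = t ^ m := by
    intro t ht m
    rw [← zpow_natCast, ZMod.val_intCast]
    conv_rhs => rw [← Int.emod_add_mul_ediv m p, zpow_add, zpow_mul, zpow_natCast, ht, one_zpow,
      mul_one]
  let f : ZMod p × ZMod p → π.ker := fun c => ⟨a ^ c.1.val * b ^ c.2.val, by
    rw [MonoidHom.mem_ker, map_mul, map_pow, map_pow, h.map_a, h.map_b, one_pow, one_pow, one_mul]⟩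
  have hf : Function.Bijective f := by
    constructor
    · rintro ⟨m, n⟩ ⟨m', n'⟩ heq
      have h1 : a ^ m.val * b ^ n.val = a ^ m'.val * b ^ n'.val := congrArg Subtype.val heq
      have h2 : a ^ ((m.val : ℤ) - m'.val) * b ^ ((n.val : ℤ) - n'.val) = 1 := by
        rw [zpow_sub, zpow_sub, zpow_natCast, zpow_natCast, zpow_natCast, zpow_natCast]
        have h3 : a ^ m.val * (a ^ m'.val)⁻¹ = (a ^ m'.val)⁻¹ * a ^ m.val :=
          ((Commute.refl a).pow_pow _ _).inv_right.eq
        rw [h3, mul_assoc, ← mul_assoc (a ^ m.val), h1]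
        group
      obtain ⟨h3, h4⟩ := h.indep _ _ h2
      rw [← ZMod.intCast_zmod_eq_zero_iff_dvd, Int.cast_sub, sub_eq_zero] at h3 h4
      simp only [Int.cast_natCast, ZMod.natCast_zmod_val] at h3 h4
      rw [h3, h4]
    · rintro ⟨k, hk⟩
      obtain ⟨m, n, rfl⟩ := h.exists_eq_zpow_mul_zpow hk
      refine ⟨((m : ZMod p), (n : ZMod p)), Subtype.ext ?_⟩
      simp only [f]
      rw [hval a h.a_pow, hval b h.b_pow]
  rw [← Nat.card_congr (Equiv.ofBijective f hf), Nat.card_prod, Nat.card_zmod, sq]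

theorem card_target (s : ℕ) :
    Nat.card (Multiplicative (ZMod s) × Multiplicative (ZMod 2)) = 2 * s := by
  rw [Nat.card_prod, Nat.card_congr Multiplicative.toAdd, Nat.card_congr Multiplicative.toAdd,
    Nat.card_zmod, Nat.card_zmod, mul_comm]

theorem index_ker (h : MetaPres p r s π a b x y) : π.ker.index = 2 * s := by
  rw [Subgroup.index_ker, MonoidHom.range_eq_top.mpr h.surjective, Subgroup.card_top, card_target]

theorem card (h : MetaPres p r s π a b x y) : Nat.card G = 2 * s * p ^ 2 := by
  rw [← Subgroup.card_mul_index π.ker, h.card_ker, h.index_ker, mul_comm]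

theorem finite (h : MetaPres p r s π a b x y) : Finite G := by
  apply Nat.finite_of_card_ne_zero
  rw [h.card]
  have := h.s_pos
  have := h.prime.pos
  positivity

/-- The subgroup generated by `t` and the kernel of `π`. -/
def sub (π : G →* Multiplicative (ZMod s) × Multiplicative (ZMod 2)) (t : G) : Subgroup G :=
  (Subgroup.zpowers (π t)).comap π

instance (t : G) : (sub π t).Normal := by unfold sub; infer_instance

theorem mem_sub_self (t : G) : t ∈ sub π t := Subgroup.mem_zpowers (π t)

theorem ker_le_sub (t : G) : π.ker ≤ sub π t := fun g hg => by
  rw [sub, Subgroup.mem_comap, MonoidHom.mem_ker.mp hg]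
  exact Subgroup.one_mem _

theorem sub_one : sub π 1 = π.ker := by
  rw [sub, map_one, Subgroup.zpowers_one_eq_bot, MonoidHom.comap_bot]

theorem index_sub (h : MetaPres p r s π a b x y) (t : G) :
    (sub π t).index * orderOf (π t) = 2 * s := by
  rw [sub, Subgroup.index_comap_of_surjective _ h.surjective, ← Nat.card_zpowers,
    Subgroup.index_mul_card, card_target]

theorem sub_eq_closure (h : MetaPres p r s π a b x y) (t : G) :
    sub π t = Subgroup.closure {t, a, b} := by
  have hle : Subgroup.closure {a, b} ≤ Subgroup.closure {t, a, b} :=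
    Subgroup.closure_mono (by simp)
  apply le_antisymm
  · intro g hg
    obtain ⟨n, hn⟩ := Subgroup.mem_zpowers_iff.mp (Subgroup.mem_comap.mp hg)
    have h1 : (t ^ n)⁻¹ * g ∈ π.ker := by
      rw [MonoidHom.mem_ker, map_mul, map_inv, map_zpow, hn, inv_mul_cancel]
    rw [h.ker_eq_closure] at h1
    have h2 := Subgroup.mul_mem _ (Subgroup.zpow_mem _ (Subgroup.subset_closure
      (show t ∈ ({t, a, b} : Set G) by simp)) n) (hle h1)
    rwa [mul_inv_cancel_left] at h2
  · rw [Subgroup.closure_le]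
    rintro _ (rfl | rfl | rfl)
    · exact mem_sub_self _
    · exact ker_le_sub t h.map_a
    · exact ker_le_sub t h.map_b

theorem conj_x_pow_a (h : MetaPres p r s π a b x y) (i : ℕ) :
    (x ^ i)⁻¹ * a * x ^ i = a ^ r ^ i := by
  induction i with
  | zero => simp
  | succ i ih =>
    have : (x ^ (i + 1))⁻¹ * a * x ^ (i + 1) = x⁻¹ * ((x ^ i)⁻¹ * a * x ^ i) * x := by
      rw [pow_succ]; group
    rw [this, ih, pow_succ', pow_mul, ← h.conj_x_a]
    simpa using (conj_pow (a := x⁻¹) (b := a) (i := r ^ i)).symm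

theorem conj_x_pow_b (h : MetaPres p r s π a b x y) (i : ℕ) :
    (x ^ i)⁻¹ * b * x ^ i = b ^ r ^ i := by
  induction i with
  | zero => simp
  | succ i ih =>
    have : (x ^ (i + 1))⁻¹ * b * x ^ (i + 1) = x⁻¹ * ((x ^ i)⁻¹ * b * x ^ i) * x := by
      rw [pow_succ]; group
    rw [this, ih, pow_succ', pow_mul, ← h.conj_x_b]
    simpa using (conj_pow (a := x⁻¹) (b := b) (i := r ^ i)).symm

theorem conj_xy_a (h : MetaPres p r s π a b x y) (i : ℕ) :
    (x ^ i * y)⁻¹ * a * (x ^ i * y) = b ^ r ^ i := by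
  have : (x ^ i * y)⁻¹ * a * (x ^ i * y) = y⁻¹ * ((x ^ i)⁻¹ * a * x ^ i) * y := by group
  rw [this, h.conj_x_pow_a, ← h.conj_y_a]
  simpa using (conj_pow (a := y⁻¹) (b := a) (i := r ^ i)).symm

theorem conj_xy_b (h : MetaPres p r s π a b x y) (i : ℕ) :
    (x ^ i * y)⁻¹ * b * (x ^ i * y) = a ^ r ^ i := by
  have : (x ^ i * y)⁻¹ * b * (x ^ i * y) = y⁻¹ * ((x ^ i)⁻¹ * b * x ^ i) * y := by group
  rw [this, h.conj_x_pow_b, ← h.conj_y_b]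
  simpa using (conj_pow (a := y⁻¹) (b := b) (i := r ^ i)).symm

theorem exists_eq_mul (h : MetaPres p r s π a b x y) (g : G) :
    ∃ i : ℕ, ∃ k ∈ π.ker, g = x ^ i * k ∨ g = x ^ i * y * k := by
  obtain ⟨i, j, k, hk, rfl⟩ := h.exists_eq_pow_mul_pow_mul g
  refine ⟨i, k, h.closure_le_ker hk, ?_⟩
  obtain ⟨m, rfl | rfl⟩ := Nat.even_or_odd' j
  · left
    rw [pow_mul, h.y_pow, one_pow, mul_one]
  · right
    rw [pow_succ, pow_mul, h.y_pow, one_pow, one_mul]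

end MetaPres

/-! ### The presented group: its projection and its action on the affine plane. -/

theorem conj_mul_inv_eq_one_iff {G : Type*} [Group G] (u v w : G) :
    u⁻¹ * v * u * w⁻¹ = 1 ↔ v * u = u * w := by
  rw [mul_inv_eq_one, mul_assoc, inv_mul_eq_iff_eq_mul]

theorem inv_mul_inv_mul_mul_eq_one_iff {G : Type*} [Group G] (u v : G) :
    u⁻¹ * v⁻¹ * u * v = 1 ↔ u * v = v * u := by
  rw [← mul_inv_rev, mul_assoc, inv_mul_eq_one, eq_comm]

/-- The projection of `MetaGroup` to the subgroup generated by `x` and `y`. -/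
def metaProj (p r s : ℕ) :
    MetaGroup p r s →* Multiplicative (ZMod s) × Multiplicative (ZMod 2) :=
  PresentedGroup.toGroup (rels := metaRels p r s)
    (f := fun
      | MetaGen.a => 1
      | MetaGen.b => 1
      | MetaGen.x => (Multiplicative.ofAdd 1, 1)
      | MetaGen.y => (1, Multiplicative.ofAdd 1)) (by
    have h2 : (2 : ZMod 2) = 0 := rfl
    simp only [metaRels, Set.mem_insert_iff, Set.mem_singleton_iff, forall_eq_or_imp, forall_eq,
      map_mul, map_pow, map_inv, FreeGroup.lift_apply_of]
    simp [← ofAdd_nsmul, h2])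

theorem Equiv.addRight_pow {V : Type*} [AddGroup V] (v : V) (n : ℕ) :
    (Equiv.addRight v : Equiv.Perm V) ^ n = Equiv.addRight (n • v) := by
  induction n with
  | zero => ext; simp
  | succ n ih => rw [pow_succ, ih]; ext w; simp [succ_nsmul', add_assoc]

theorem Equiv.addRight_zpow {V : Type*} [AddGroup V] (v : V) (n : ℤ) :
    (Equiv.addRight v : Equiv.Perm V) ^ n = Equiv.addRight (n • v) := by
  cases n with
  | ofNat n => rw [Int.ofNat_eq_natCast, zpow_natCast, Equiv.addRight_pow, natCast_zsmul]
  | negSucc n =>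
    rw [zpow_negSucc, Equiv.addRight_pow, negSucc_zsmul, inv_eq_iff_mul_eq_one]
    ext w
    simp

/-- The action of `MetaGroup` on the plane over `ZMod p`. -/
def metaPerm (p r s : ℕ) (hp : Nat.Coprime r p) (hs : (r : ZMod p) ^ s = 1) :
    MetaGroup p r s →* Equiv.Perm (ZMod p × ZMod p) :=
  PresentedGroup.toGroup (rels := metaRels p r s)
    (f := fun
      | MetaGen.a => Equiv.addRight (1, 0)
      | MetaGen.b => Equiv.addRight (0, 1)
      -- Permutations compose from the left, so `x` must divide by `r` for `x⁻¹ * a * x` to be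
      -- translation by `(r, 0)`.
      | MetaGen.x => MulAction.toPerm (ZMod.unitOfCoprime r hp)⁻¹
      | MetaGen.y => Equiv.prodComm _ _) (by
    have hu : (ZMod.unitOfCoprime r hp)⁻¹ ^ s = 1 := by
      rw [inv_pow, inv_eq_one]
      ext
      simpa using hs
    have hur : (ZMod.unitOfCoprime r hp)⁻¹ • (r : ZMod p) = 1 := by
      rw [inv_smul_eq_iff, Units.smul_def]
      simp
    simp only [metaRels, Set.mem_insert_iff, Set.mem_singleton_iff, forall_eq_or_imp, forall_eq,
      map_mul, map_pow, map_inv, FreeGroup.lift_apply_of, Equiv.addRight_pow,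
      conj_mul_inv_eq_one_iff, inv_mul_inv_mul_mul_eq_one_iff]
    refine ⟨?_, ?_, ?_, ?_, ?_, ?_, ?_, ?_, ?_, ?_⟩
    · ext v <;> simp
    · ext v <;> simp
    · rw [← MulAction.toPermHom_apply, ← map_pow, hu, map_one]
    · ext v <;> simp [sq]
    · ext v <;> simp
    · ext v <;> simp
    · ext v <;> simp [hur]
    · ext v <;> simp [hur]
    · ext v <;> simp
    · ext v <;> simp)

theorem metaPres_metaGroup {p r s : ℕ} (hp : p.Prime) (hrp : Nat.Coprime r p) (hs0 : 0 < s)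
    (hs : (r : ZMod p) ^ s = 1) :
    MetaPres p r s (metaProj p r s) (PresentedGroup.of MetaGen.a) (PresentedGroup.of MetaGen.b)
      (PresentedGroup.of MetaGen.x) (PresentedGroup.of MetaGen.y) := by
  have rel : ∀ w ∈ metaRels p r s, PresentedGroup.mk (metaRels p r s) w = 1 := fun w hw =>
    PresentedGroup.one_of_mem hw
  simp only [metaRels, Set.mem_insert_iff, Set.mem_singleton_iff, forall_eq_or_imp,
    forall_eq] at rel
  obtain ⟨h1, h2, h3, h4, h5, h6, h7, h8, h9, h10⟩ := rel
  refine ⟨hp, hs0, h1, h2, h3, h4, (inv_mul_inv_mul_mul_eq_one_iff _ _).mp h5,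
    (inv_mul_inv_mul_mul_eq_one_iff _ _).mp h6, ?_, ?_, ?_, ?_, ?_, ?_, ?_, ?_, ?_, ?_⟩
  · exact mul_inv_eq_one.mp h7
  · exact mul_inv_eq_one.mp h8
  · exact mul_inv_eq_one.mp h9
  · exact mul_inv_eq_one.mp h10
  · exact PresentedGroup.toGroup.of _
  · exact PresentedGroup.toGroup.of _
  · exact PresentedGroup.toGroup.of _
  · exact PresentedGroup.toGroup.of _
  · rw [← PresentedGroup.closure_range_of]
    congr 1
    ext g
    constructor
    · rintro (rfl | rfl | rfl | rfl)
      exacts [⟨_, rfl⟩, ⟨_, rfl⟩, ⟨_, rfl⟩, ⟨_, rfl⟩]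
    · rintro ⟨_ | _ | _ | _, rfl⟩ <;> simp
  · intro m n hmn
    -- The element `a ^ m * b ^ n` moves the origin to `(m, n)`.
    have h := congrArg (fun e => metaPerm p r s hrp hs e (0, 0)) hmn
    simp only [map_mul, map_zpow, map_one] at h
    have ha : metaPerm p r s hrp hs (PresentedGroup.of MetaGen.a) = Equiv.addRight (1, 0) :=
      PresentedGroup.toGroup.of _
    have hb : metaPerm p r s hrp hs (PresentedGroup.of MetaGen.b) = Equiv.addRight (0, 1) :=
      PresentedGroup.toGroup.of _
    rw [ha, hb, Equiv.addRight_zpow, Equiv.addRight_zpow] at h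
    simpa [ZMod.intCast_zmod_eq_zero_iff_dvd] using h

theorem commute_of_mem_closure {G M : Type*} [Group G] [Monoid M] (φ : G →* M) {S : Set G}
    (hS : ∀ u ∈ S, ∀ v ∈ S, Commute (φ u) (φ v)) {u v : G} (hu : u ∈ Subgroup.closure S)
    (hv : v ∈ Subgroup.closure S) : Commute (φ u) (φ v) := by
  have inv_left : ∀ g (m : M), Commute (φ g) m → Commute (φ g⁻¹) m := by
    intro g m hg
    have h1 : φ g⁻¹ * φ g = 1 := by rw [← map_mul, inv_mul_cancel, map_one]
    have h2 : φ g * φ g⁻¹ = 1 := by rw [← map_mul, mul_inv_cancel, map_one]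
    calc φ g⁻¹ * m = φ g⁻¹ * m * (φ g * φ g⁻¹) := by rw [h2, mul_one]
      _ = φ g⁻¹ * (m * φ g) * φ g⁻¹ := by simp only [mul_assoc]
      _ = φ g⁻¹ * φ g * m * φ g⁻¹ := by rw [← hg.eq]; simp only [mul_assoc]
      _ = m * φ g⁻¹ := by rw [h1, one_mul]
  have key : ∀ m : M, (∀ u ∈ S, Commute (φ u) m) → ∀ u ∈ Subgroup.closure S, Commute (φ u) m := by
    intro m hm u hu
    induction hu using Subgroup.closure_induction with
    | mem g hg => exact hm g hg
    | one => rw [map_one]; exact Commute.one_left m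
    | mul g g' _ _ ih ih' => rw [map_mul]; exact ih.mul_left ih'
    | inv g _ ih => exact inv_left g m ih
  exact key _ (fun s hs => (key _ (fun t ht => hS t ht s hs) v hv).symm) u hu

/-! ### Eigencharacters of `T` under conjugation and powers. -/

section Eigen

variable {F : Type*} [Field F] {G : Type*} [Group G] {D : Type*} [Field D] [Algebra F D]
  {d : ℕ} {Ω : Type*} [Field Ω] [Algebra F Ω] [Algebra D Ω] [IsScalarTower F D Ω]
  {ρ : MonoidAlgebra F G →ₐ[F] Matrix (Fin d) (Fin d) D}
  {T : Subgroup G} {w : Fin d → Ω} {χ : G → Ω}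

theorem map_eq_one_of_fixed_closure [Finite G] (hρ : Function.Surjective ρ) (N : Subgroup G)
    [N.Normal] {S : Set G} (hS : N = Subgroup.closure S) (hw0 : w ≠ 0)
    (hw : ∀ n ∈ S, extGroupAction Ω ρ n w = w) {n : G} (hn : n ∈ N) :
    ρ (MonoidAlgebra.of F G n) = 1 := by
  refine map_eq_one_of_fixed (Ω := Ω) hρ N hw0 (fun n hn => ?_) n hn
  rw [hS] at hn
  induction hn using Subgroup.closure_induction with
  | mem g hg => exact hw g hg
  | one => rw [map_one]; rfl
  | mul g g' _ _ ih ih' => rw [map_mul, Module.End.mul_apply, ih', ih]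
  | inv g _ ih =>
    conv_lhs => rw [← ih]
    rw [← Module.End.mul_apply, ← map_mul, inv_mul_cancel, map_one]; rfl

theorem eigenvalue_conj_mul [T.Normal] (hw0 : w ≠ 0)
    (hw : ∀ t ∈ T, extGroupAction Ω ρ t w = χ t • w) (u : G) {k t : G} (hk : k ∈ T) (ht : t ∈ T) :
    χ ((u * k)⁻¹ * t * (u * k)) = χ (u⁻¹ * t * u) := by
  have hut : u⁻¹ * t * u ∈ T := by simpa using ‹T.Normal›.conj_mem t ht u⁻¹
  have : (u * k)⁻¹ * t * (u * k) = k⁻¹ * (u⁻¹ * t * u) * k := by group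
  rw [this, eigenvalue_mul hw0 hw (T.mul_mem (T.inv_mem hk) hut) hk,
    eigenvalue_mul hw0 hw (T.inv_mem hk) hut, eigenvalue_inv hw0 hw hk, mul_right_comm,
    inv_mul_cancel₀ (eigenvalue_ne_zero hw0 hw hk), one_mul]

theorem eigenvalue_pow_eq_of_closure [T.Normal] (hw0 : w ≠ 0)
    (hw : ∀ t ∈ T, extGroupAction Ω ρ t w = χ t • w) {S : Set G} (hT : T = Subgroup.closure S)
    {n : ℕ} {g : G} (hS : ∀ t ∈ S, χ t ^ n = χ (g⁻¹ * t * g)) {t : G} (ht : t ∈ T) :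
    χ t ^ n = χ (g⁻¹ * t * g) := by
  have hconj : ∀ t ∈ T, g⁻¹ * t * g ∈ T := fun t ht => by
    simpa using ‹T.Normal›.conj_mem t ht g⁻¹
  rw [hT] at ht
  induction ht using Subgroup.closure_induction with
  | mem t ht => exact hS t ht
  | one => simp [eigenvalue_one hw0 hw]
  | mul t t' ht ht' ih ih' =>
    rw [← hT] at ht ht'
    rw [eigenvalue_mul hw0 hw ht ht', mul_pow, ih, ih',
      ← eigenvalue_mul hw0 hw (hconj t ht) (hconj t' ht')]
    congr 1
    group
  | inv t ht ih =>
    rw [← hT] at ht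
    rw [eigenvalue_inv hw0 hw ht, inv_pow, ih, ← eigenvalue_inv hw0 hw (hconj t ht)]
    congr 1
    group

theorem eigenvalue_pow_eq_one (hw0 : w ≠ 0)
    (hw : ∀ t ∈ T, extGroupAction Ω ρ t w = χ t • w) {t : G} (ht : t ∈ T) {n : ℕ}
    (h : t ^ n = 1) : χ t ^ n = 1 := by
  rw [← eigenvalue_pow hw0 hw ht, h, eigenvalue_one hw0 hw]

end Eigen

/-! ### Arithmetic of exponents -/

section Exponents

variable {Ω : Type*} [Field Ω] {p : ℕ} {α β : Ω}

theorem pow_eq_pow_of_zmod_eq (hp : p.Prime) (hα : α ^ p = 1) {m n : ℕ} (h : (m : ZMod p) = n) :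
    α ^ m = α ^ n :=
  (isOfFinOrder_iff_pow_eq_one.mpr ⟨p, hp.pos, hα⟩).pow_eq_pow_iff_modEq.mpr
    (((ZMod.natCast_eq_natCast_iff m n p).mp h).of_dvd
    (orderOf_dvd_of_pow_eq_one hα))

theorem zmod_eq_of_pow_eq_pow (hp : p.Prime) (hα : α ^ p = 1) (hα1 : α ≠ 1) {m n : ℕ}
    (h : α ^ m = α ^ n) : (m : ZMod p) = n := by
  have : Fact p.Prime := ⟨hp⟩
  rw [ZMod.natCast_eq_natCast_iff, ← orderOf_eq_prime hα hα1]
  exact (isOfFinOrder_iff_pow_eq_one.mpr ⟨p, hp.pos, hα⟩).pow_eq_pow_iff_modEq.mp h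

theorem zmod_eq_neg_of_pow_eq_inv_pow (hp : p.Prime) (hα : α ^ p = 1) (hα1 : α ≠ 1) {m n : ℕ}
    (h : α ^ m = α⁻¹ ^ n) : (m : ZMod p) = -n := by
  have h0 : α ≠ 0 := fun h0 => by simp [h0, hp.ne_zero] at hα
  have h1 : α ^ (m + n) = α ^ 0 := by
    rw [pow_add, h, ← mul_pow, inv_mul_cancel₀ h0, one_pow, pow_zero]
  have h2 := zmod_eq_of_pow_eq_pow hp hα hα1 h1
  rw [Nat.cast_add, Nat.cast_zero] at h2
  exact eq_neg_of_add_eq_zero_left h2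

theorem pow_eq_inv_pow_of_zmod_eq_neg (hp : p.Prime) (hα : α ^ p = 1) {m n : ℕ}
    (h : (m : ZMod p) = -n) : α ^ m = α⁻¹ ^ n := by
  have h0 : α ≠ 0 := fun h0 => by simp [h0, hp.ne_zero] at hα
  have h1 : α ^ (m + n) = α ^ 0 := pow_eq_pow_of_zmod_eq hp hα (by simp [h])
  rw [pow_add, pow_zero] at h1
  rw [inv_pow]
  exact eq_inv_of_mul_eq_one_left h1

theorem eq_one_of_pow_eq_one_of_zmod_ne_zero (hp : p.Prime) (hα : α ^ p = 1) {n : ℕ}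
    (hn : (n : ZMod p) ≠ 0) (h : α ^ n = 1) : α = 1 := by
  by_contra hα1
  exact hn (by simpa using zmod_eq_of_pow_eq_pow (m := n) (n := 0) hp hα hα1 (by simpa using h))

/-- If powers exchange two `p`-th roots of unity, these are equal or inverse to each other. -/
theorem eq_or_mul_eq_one_of_pow_swap (hp : p.Prime) (hα : α ^ p = 1) (hβ : β ^ p = 1) {m n : ℕ}
    (hn : (n : ZMod p) ≠ 0) (h1 : α ^ m = β ^ n) (h2 : β ^ m = α ^ n) : α = β ∨ α * β = 1 := by
  have : Fact p.Prime := ⟨hp⟩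
  by_cases hα1 : α = 1
  · subst hα1
    rw [one_pow] at h1
    exact Or.inl (eq_one_of_pow_eq_one_of_zmod_ne_zero hp hβ hn h1.symm).symm
  have h0 : β ≠ 0 := fun h0 => by simp [h0, hp.ne_zero] at hβ
  have h3 : α ^ (m * m) = α ^ (n * n) := by
    rw [pow_mul, h1, ← pow_mul, mul_comm, pow_mul, h2, ← pow_mul]
  -- Applying the exchange twice gives `m ^ 2 = n ^ 2` in the field `ZMod p`, so `m = ±n`; the sign
  -- selects the alternative.
  have h4 := zmod_eq_of_pow_eq_pow hp hα hα1 h3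
  push_cast at h4
  rcases mul_self_eq_mul_self_iff.mp h4 with h5 | h5
  · left
    have h6 : α ^ n = β ^ n := by rw [← h1, pow_eq_pow_of_zmod_eq hp hα h5]
    have h7 : (α / β) ^ n = 1 := by rw [div_pow, h6, div_self (pow_ne_zero _ h0)]
    exact (div_eq_one_iff_eq h0).mp
      (eq_one_of_pow_eq_one_of_zmod_ne_zero hp (by rw [div_pow, hα, hβ, div_one]) hn h7)
  · right
    have h6 : α⁻¹ ^ n = β ^ n := by rw [← h1, pow_eq_inv_pow_of_zmod_eq_neg hp hα h5]
    have h7 : (α * β) ^ n = 1 := by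
      have hα0 : α ≠ 0 := fun h0 => by simp [h0, hp.ne_zero] at hα
      rw [mul_pow, ← h6, ← mul_pow, mul_inv_cancel₀ hα0, one_pow]
    exact eq_one_of_pow_eq_one_of_zmod_ne_zero hp (by rw [mul_pow, hα, hβ, one_mul]) hn h7

end Exponents

/-- In a field the powers of `r` exhaust the roots of `X ^ orderOf r - 1`. -/
theorem exists_eq_pow_of_pow_orderOf_eq_one {p : ℕ} (hp : p.Prime) {r v : ZMod p}
    (hr : 0 < orderOf r) (hv : v ^ orderOf r = 1) : ∃ i, v = r ^ i := by
  have : Fact p.Prime := ⟨hp⟩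
  have : NeZero (orderOf r) := ⟨hr.ne'⟩
  obtain ⟨i, _, hi⟩ := (IsPrimitiveRoot.orderOf r).eq_pow_of_pow_eq_one hv
  exact ⟨i, hi.symm⟩

/-! ### Normal subgroups -/

namespace MetaPres

variable {G : Type*} [Group G] {p r s : ℕ}
  {π : G →* Multiplicative (ZMod s) × Multiplicative (ZMod 2)} {a b x y : G}

theorem ker_comm (h : MetaPres p r s π a b x y) {k k' : G} (hk : k ∈ π.ker) (hk' : k' ∈ π.ker) :
    Commute k k' := by
  rw [h.ker_eq_closure] at hk hk'
  refine commute_of_mem_closure (MonoidHom.id G) ?_ hk hk'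
  rintro u (rfl | rfl) v (rfl | rfl)
  exacts [Commute.refl _, h.comm_ab, h.comm_ab.symm, Commute.refl _]

/-- Conjugation by `x` and `y` is enough to check: the rest of the group comes from the kernel,
which is abelian and contains `c`. -/
theorem normal_zpowers (h : MetaPres p r s π a b x y) {c : G} (hc : c ∈ π.ker)
    (hx : x⁻¹ * c * x ∈ Subgroup.zpowers c) (hy : y⁻¹ * c * y ∈ Subgroup.zpowers c) :
    (Subgroup.zpowers c).Normal := by
  have hstep : ∀ t, t⁻¹ * c * t ∈ Subgroup.zpowers c → ∀ n ∈ Subgroup.zpowers c,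
      t⁻¹ * n * t ∈ Subgroup.zpowers c := by
    rintro t ht _ ⟨m, rfl⟩
    have := (Subgroup.zpowers c).zpow_mem ht m
    have e := conj_zpow (a := t⁻¹) (b := c) (i := m)
    rw [inv_inv] at e
    rw [← e]
    exact this
  have hpow : ∀ t, t⁻¹ * c * t ∈ Subgroup.zpowers c → ∀ i : ℕ, ∀ n ∈ Subgroup.zpowers c,
      (t ^ i)⁻¹ * n * t ^ i ∈ Subgroup.zpowers c := by
    intro t ht i
    induction i with
    | zero => simp
    | succ i ih =>
      intro n hn
      have := hstep t ht _ (ih n hn)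
      convert this using 1
      rw [pow_succ]
      group
  refine ⟨fun n hn g => ?_⟩
  obtain ⟨i, j, k, hk, e⟩ := h.exists_eq_pow_mul_pow_mul g⁻¹
  have h1 := hpow y hy j _ (hpow x hx i n hn)
  have h2 : g * n * g⁻¹ = k⁻¹ * ((y ^ j)⁻¹ * ((x ^ i)⁻¹ * n * x ^ i) * y ^ j) * k := by
    rw [← inv_inv g, inv_inv g⁻¹, e]
    group
  rw [h2]
  have hle : Subgroup.zpowers c ≤ π.ker := by rwa [Subgroup.zpowers_le]
  rw [mul_assoc, (h.ker_comm (hle h1) (h.closure_le_ker hk)).eq, inv_mul_cancel_left]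
  exact h1

theorem index_zpowers (h : MetaPres p r s π a b x y) {c : G} (hc : c ^ p = 1) (hc1 : c ≠ 1) :
    (Subgroup.zpowers c).index = 2 * s * p := by
  have : Fact p.Prime := ⟨h.prime⟩
  have h1 := Subgroup.index_mul_card (Subgroup.zpowers c)
  rw [Nat.card_zpowers, orderOf_eq_prime hc hc1, h.card, sq, ← mul_assoc] at h1
  exact Nat.eq_of_mul_eq_mul_right h.prime.pos h1

theorem a_mem_ker (h : MetaPres p r s π a b x y) : a ∈ π.ker := h.map_a

theorem b_mem_ker (h : MetaPres p r s π a b x y) : b ∈ π.ker := h.map_b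

theorem mul_ne_one (h : MetaPres p r s π a b x y) : a * b ≠ 1 := by
  intro e
  have := (h.indep 1 1 (by simpa using e)).1
  exact h.prime.one_lt.not_ge (Nat.le_of_dvd one_pos (by exact_mod_cast this))

theorem mul_inv_ne_one (h : MetaPres p r s π a b x y) : a * b⁻¹ ≠ 1 := by
  intro e
  have := (h.indep 1 (-1) (by simpa using e)).1
  exact h.prime.one_lt.not_ge (Nat.le_of_dvd one_pos (by exact_mod_cast this))

theorem mul_pow_eq_one (h : MetaPres p r s π a b x y) : (a * b) ^ p = 1 := by
  rw [h.comm_ab.mul_pow, h.a_pow, h.b_pow, one_mul]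

theorem mul_inv_pow_eq_one (h : MetaPres p r s π a b x y) : (a * b⁻¹) ^ p = 1 := by
  rw [h.comm_ab.inv_right.mul_pow, h.a_pow, inv_pow, h.b_pow, inv_one, one_mul]

theorem normal_zpowers_mul (h : MetaPres p r s π a b x y) : (Subgroup.zpowers (a * b)).Normal := by
  refine h.normal_zpowers (mul_mem h.a_mem_ker h.b_mem_ker) ?_ ?_
  · have : x⁻¹ * (a * b) * x = (x⁻¹ * a * x) * (x⁻¹ * b * x) := by group
    rw [this, h.conj_x_a, h.conj_x_b, ← h.comm_ab.mul_pow]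
    exact Subgroup.npow_mem_zpowers _ _
  · have : y⁻¹ * (a * b) * y = (y⁻¹ * a * y) * (y⁻¹ * b * y) := by group
    rw [this, h.conj_y_a, h.conj_y_b, ← h.comm_ab.eq]
    exact Subgroup.mem_zpowers _

theorem normal_zpowers_mul_inv (h : MetaPres p r s π a b x y) :
    (Subgroup.zpowers (a * b⁻¹)).Normal := by
  refine h.normal_zpowers (mul_mem h.a_mem_ker (inv_mem h.b_mem_ker)) ?_ ?_
  · have : x⁻¹ * (a * b⁻¹) * x = (x⁻¹ * a * x) * (x⁻¹ * b * x)⁻¹ := by group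
    rw [this, h.conj_x_a, h.conj_x_b, ← inv_pow, ← h.comm_ab.inv_right.mul_pow]
    exact Subgroup.npow_mem_zpowers _ _
  · have : y⁻¹ * (a * b⁻¹) * y = (y⁻¹ * a * y) * (y⁻¹ * b * y)⁻¹ := by group
    rw [this, h.conj_y_a, h.conj_y_b]
    have h2 : b * a⁻¹ = (a * b⁻¹)⁻¹ := by group
    rw [h2]
    exact Subgroup.inv_mem _ (Subgroup.mem_zpowers _)

end MetaPres

/-! ### The simple factors of the group algebra -/

/-- The restriction of a matrix representation of a group algebra to the group. -/
noncomputable def groupHom {F : Type*} [Field F] {G : Type*} [Group G] {D : Type*} [Field D]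
    [Algebra F D] {d : ℕ} (ρ : MonoidAlgebra F G →ₐ[F] Matrix (Fin d) (Fin d) D) :
    G →* Matrix (Fin d) (Fin d) D :=
  (ρ : MonoidAlgebra F G →* Matrix (Fin d) (Fin d) D).comp (MonoidAlgebra.of F G)

namespace MetaPres

variable {F : Type*} [Field F] {G : Type*} [Group G] {D : Type*} [Field D] [Algebra F D]
  {d : ℕ} {ρ : MonoidAlgebra F G →ₐ[F] Matrix (Fin d) (Fin d) D}
  {p r s : ℕ} {π : G →* Multiplicative (ZMod s) × Multiplicative (ZMod 2)} {a b x y : G}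

section Eigen

variable {Ω : Type*} [Field Ω] [Algebra F Ω] [Algebra D Ω] [IsScalarTower F D Ω]
  {w : Fin d → Ω} {χ : G → Ω}

/-- The kernel lies in `T` and so does not move `χ`; only the coset of `g` modulo the kernel
matters. All stabiliser and Frobenius computations below reduce to these two cases. -/
theorem eigenvalue_conj_cases (h : MetaPres p r s π a b x y) {T : Subgroup G} [T.Normal]
    (hT : π.ker ≤ T) (hw0 : w ≠ 0) (hw : ∀ t ∈ T, extGroupAction Ω ρ t w = χ t • w) (g : G) :
    ∃ i : ℕ, ∃ k ∈ π.ker,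
      (g = x ^ i * k ∧ χ (g⁻¹ * a * g) = χ a ^ r ^ i ∧ χ (g⁻¹ * b * g) = χ b ^ r ^ i) ∨
      (g = x ^ i * y * k ∧ χ (g⁻¹ * a * g) = χ b ^ r ^ i ∧ χ (g⁻¹ * b * g) = χ a ^ r ^ i) := by
  have haT := hT h.a_mem_ker
  have hbT := hT h.b_mem_ker
  obtain ⟨i, k, hk, rfl | rfl⟩ := h.exists_eq_mul g
  · refine ⟨i, k, hk, Or.inl ⟨rfl, ?_, ?_⟩⟩
    · rw [eigenvalue_conj_mul hw0 hw _ (hT hk) haT, h.conj_x_pow_a, eigenvalue_pow hw0 hw haT]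
    · rw [eigenvalue_conj_mul hw0 hw _ (hT hk) hbT, h.conj_x_pow_b, eigenvalue_pow hw0 hw hbT]
  · refine ⟨i, k, hk, Or.inr ⟨rfl, ?_, ?_⟩⟩
    · rw [eigenvalue_conj_mul hw0 hw _ (hT hk) haT, h.conj_xy_a, eigenvalue_pow hw0 hw hbT]
    · rw [eigenvalue_conj_mul hw0 hw _ (hT hk) hbT, h.conj_xy_b, eigenvalue_pow hw0 hw haT]

/-- The extra generator `t₀` imposes no condition: it commutes with `x`, and `χ t₀ = ±1` is
unchanged by odd powers. It is applied with `n` a power of `q` and `t₀` one of `1`, `y`, `x ^ (s/2)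
* y`. -/
theorem eigenvalue_pow_eq_conj_x (h : MetaPres p r s π a b x y) {t₀ : G} (ht₀ : t₀ ^ 2 = 1)
    (hxt₀ : Commute x t₀) (hw0 : w ≠ 0)
    (hw : ∀ t ∈ sub π t₀, extGroupAction Ω ρ t w = χ t • w) {n i : ℕ} (hn : Odd n)
    (hni : (n : ZMod p) = (r : ZMod p) ^ i) {t : G} (ht : t ∈ sub π t₀) :
    χ t ^ n = χ ((x ^ i)⁻¹ * t * x ^ i) := by
  have haT := ker_le_sub t₀ h.a_mem_ker
  have hbT := ker_le_sub t₀ h.b_mem_ker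
  rw [← Nat.cast_pow] at hni
  refine eigenvalue_pow_eq_of_closure hw0 hw (h.sub_eq_closure t₀) ?_ ht
  rintro t (rfl | rfl | rfl)
  · have h1 : (x ^ i)⁻¹ * t * x ^ i = t := by
      rw [mul_assoc, ← (hxt₀.pow_left i).eq, inv_mul_cancel_left]
    obtain ⟨m, rfl⟩ := hn
    rw [h1, pow_succ, pow_mul, eigenvalue_pow_eq_one hw0 hw (mem_sub_self t) ht₀, one_pow, one_mul]
  · rw [h.conj_x_pow_a, eigenvalue_pow hw0 hw haT]
    exact pow_eq_pow_of_zmod_eq h.prime (eigenvalue_pow_eq_one hw0 hw haT h.a_pow) hni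
  · rw [h.conj_x_pow_b, eigenvalue_pow hw0 hw hbT]
    exact pow_eq_pow_of_zmod_eq h.prime (eigenvalue_pow_eq_one hw0 hw hbT h.b_pow) hni

theorem eigenvalue_a_ne_one [Finite G] (h : MetaPres p r s π a b x y) {T : Subgroup G}
    (hT : π.ker ≤ T) (hρ : Function.Surjective ρ) (hw0 : w ≠ 0)
    (hw : ∀ t ∈ T, extGroupAction Ω ρ t w = χ t • w) (hχ : χ a = 1 → χ b = 1)
    (ha : ρ (MonoidAlgebra.of F G a) ≠ 1) : χ a ≠ 1 := by
  intro hα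
  refine ha (map_eq_one_of_fixed_closure hρ π.ker h.ker_eq_closure hw0 ?_ h.a_mem_ker)
  rintro _ (rfl | rfl)
  · rw [hw _ (hT h.a_mem_ker), hα, one_smul]
  · rw [hw _ (hT h.b_mem_ker), hχ hα, one_smul]

/-- An equality of eigenvalues on the single vector `w` becomes one of operators, because `⟨ab⁻¹⟩`
is normal and fixes `w`. -/
theorem eigenvalue_ne [Finite G] (h : MetaPres p r s π a b x y) {T : Subgroup G}
    (hT : π.ker ≤ T) (hρ : Function.Surjective ρ) (hw0 : w ≠ 0)
    (hw : ∀ t ∈ T, extGroupAction Ω ρ t w = χ t • w)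
    (hab : ρ (MonoidAlgebra.of F G a) ≠ ρ (MonoidAlgebra.of F G b)) : χ a ≠ χ b := by
  intro hαβ
  have := h.normal_zpowers_mul_inv
  have haT := hT h.a_mem_ker
  have hbT := hT h.b_mem_ker
  apply hab
  have h1 : ρ (MonoidAlgebra.of F G (a * b⁻¹)) = 1 := by
    refine map_eq_one_of_fixed_closure hρ _ (Subgroup.zpowers_eq_closure (a * b⁻¹)) hw0 ?_
      (Subgroup.mem_zpowers _)
    rintro _ rfl
    rw [hw _ (T.mul_mem haT (T.inv_mem hbT)), eigenvalue_mul hw0 hw haT (T.inv_mem hbT),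
      eigenvalue_inv hw0 hw hbT, hαβ, mul_inv_cancel₀ (eigenvalue_ne_zero hw0 hw hbT), one_smul]
  have h2 : MonoidAlgebra.of F G a = MonoidAlgebra.of F G (a * b⁻¹) * MonoidAlgebra.of F G b := by
    rw [← map_mul, inv_mul_cancel_right]
  rw [h2, map_mul, h1, one_mul]

theorem eigenvalue_mul_ne_one [Finite G] (h : MetaPres p r s π a b x y) {T : Subgroup G}
    (hT : π.ker ≤ T) (hρ : Function.Surjective ρ) (hw0 : w ≠ 0)
    (hw : ∀ t ∈ T, extGroupAction Ω ρ t w = χ t • w)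
    (hab : ρ (MonoidAlgebra.of F G (a * b)) ≠ 1) : χ a * χ b ≠ 1 := by
  intro hαβ
  have := h.normal_zpowers_mul
  have haT := hT h.a_mem_ker
  have hbT := hT h.b_mem_ker
  refine hab (map_eq_one_of_fixed_closure hρ _ (Subgroup.zpowers_eq_closure (a * b)) hw0 ?_
      (Subgroup.mem_zpowers _))
  rintro _ rfl
  rw [hw _ (T.mul_mem haT hbT), eigenvalue_mul hw0 hw haT hbT, hαβ, one_smul]

end Eigen

theorem x_pow_eq_one (h : MetaPres p r s π a b x y) (hs : s = orderOf (r : ZMod p))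
    {i : ℕ} (hi : (r : ZMod p) ^ i = 1) :
    x ^ i = 1 := by
  obtain ⟨m, rfl⟩ := hs ▸ orderOf_dvd_of_pow_eq_one hi
  rw [pow_mul, h.x_pow, one_pow]

theorem zmod_ne_zero (h : MetaPres p r s π a b x y) (hs : s = orderOf (r : ZMod p))
    (i : ℕ) : ((r ^ i : ℕ) : ZMod p) ≠ 0 := by
  have : Fact p.Prime := ⟨h.prime⟩
  intro h0
  rw [Nat.cast_pow] at h0
  have h1 : (r : ZMod p) = 0 := by
    by_contra hr
    exact pow_ne_zero i hr h0
  have h2 := pow_orderOf_eq_one (r : ZMod p)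
  rw [← hs, h1, zero_pow h.s_pos.ne'] at h2
  exact zero_ne_one h2

/-- The powers of `r` are all the solutions of `u ^ s = 1` in `ZMod p`. -/
theorem orderOf_dvd_mul_iff (h : MetaPres p r s π a b x y) (hs : s = orderOf (r : ZMod p))
    (v : ZMod p) (k : ℕ) :
    orderOf v ∣ k * s ↔ ∃ i, v ^ k = (r : ZMod p) ^ i := by
  rw [orderOf_dvd_iff_pow_eq_one, pow_mul]
  constructor
  · intro hv
    rw [hs] at hv
    exact exists_eq_pow_of_pow_orderOf_eq_one h.prime (hs ▸ h.s_pos) hv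
  · rintro ⟨i, hi⟩
    rw [hi, ← pow_mul, mul_comm, pow_mul, hs, pow_orderOf_eq_one, one_pow]

section Factors

theorem exists_eigenvector_ker (h : MetaPres p r s π a b x y) (hd : d ≠ 0) :
    ∃ (w : Fin d → AlgebraicClosure D) (χ : G → AlgebraicClosure D), w ≠ 0 ∧
      ∀ t ∈ sub π 1, extGroupAction (AlgebraicClosure D) ρ t w = χ t • w :=
  exists_eigenvector_of_commute hd (sub π 1) (by
    rw [sub_one]
    intro t ht t' ht'
    exact (h.ker_comm ht ht').map (groupHom ρ))

theorem index_sub_one (h : MetaPres p r s π a b x y) : (sub π 1).index = 2 * s := by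
  rw [sub_one, h.index_ker]

theorem map_b_eq_of_mul_eq_one {M : Type*} [Monoid M] (φ : G →* M) (hab : φ (a * b) = 1) :
    φ b⁻¹ = φ a := by
  have h1 : a = a * b * b⁻¹ := by group
  conv_rhs => rw [h1, map_mul, hab, one_mul]

variable [Finite F] [Finite G] [FiniteDimensional F D]

/-- The factors on which `a` and `b` act by the same nontrivial operator. -/
theorem factor_of_eq (h : MetaPres p r s π a b x y) (hs : s = orderOf (r : ZMod p))
    (hq : Odd (Nat.card F)) (hρ : Function.Surjective ρ) (hd : d ≠ 0)
    (hab : ρ (MonoidAlgebra.of F G a) = ρ (MonoidAlgebra.of F G b))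
    (ha : ρ (MonoidAlgebra.of F G a) ≠ 1) :
    d = s ∧ ∀ k, finrank F D ∣ k ↔ orderOf (Nat.card F : ZMod p) ∣ k * s := by
  have haT := ker_le_sub y h.a_mem_ker
  have hbT := ker_le_sub y h.b_mem_ker
  -- Conjugation by `y` exchanges `a` and `b`, which act equally here, so `⟨y, a, b⟩` acts through
  -- commuting operators.
  have hya : Commute (ρ (MonoidAlgebra.of F G y)) (ρ (MonoidAlgebra.of F G a)) := by
    have h1 : a * y = y * b := by
      rw [← h.conj_y_a]; group
    have h2 := congrArg (fun g => ρ (MonoidAlgebra.of F G g)) h1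
    simp only [map_mul] at h2
    rw [← hab] at h2
    exact h2.symm
  obtain ⟨w, χ, hw0, hw⟩ := exists_eigenvector_of_commute (Ω := AlgebraicClosure D) (ρ := ρ) hd
    (sub π y) (by
      rw [h.sub_eq_closure]
      intro t ht t' ht'
      refine commute_of_mem_closure (groupHom ρ) ?_ ht ht'
      have hyb := hya
      have hab' : Commute (ρ (MonoidAlgebra.of F G a)) (ρ (MonoidAlgebra.of F G b)) := by rw [hab]
      rw [hab] at hyb
      rintro u (rfl | rfl | rfl) v (rfl | rfl | rfl)
      exacts [Commute.refl _, hya, hyb, hya.symm, Commute.refl _, hab', hyb.symm, hab'.symm,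
        Commute.refl _])
  have hαβ : χ a = χ b := eigenvalue_eq_of_map_eq hw0 hw haT hbT hab
  have hα := h.eigenvalue_a_ne_one (ker_le_sub y) hρ hw0 hw (fun e => hαβ ▸ e) ha
  have hαp := eigenvalue_pow_eq_one hw0 hw haT h.a_pow
  have inertia : ∀ g, (∀ t ∈ sub π y, χ (g⁻¹ * t * g) = χ t) → g ∈ sub π y := by
    intro g hg
    obtain ⟨i, k, hk, hcase⟩ := h.eigenvalue_conj_cases (ker_le_sub y) hw0 hw g
    have key : χ a ^ r ^ i = χ a ^ 1 → x ^ i = 1 := fun e =>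
      h.x_pow_eq_one hs (by simpa using zmod_eq_of_pow_eq_pow h.prime hαp hα e)
    rcases hcase with ⟨rfl, h1, -⟩ | ⟨rfl, h1, -⟩
    · rw [hg a haT] at h1
      rw [key (by rw [← h1, pow_one]), one_mul]
      exact ker_le_sub y hk
    · rw [hg a haT, ← hαβ] at h1
      rw [key (by rw [← h1, pow_one]), one_mul]
      exact mul_mem (mem_sub_self y) (ker_le_sub y hk)
  constructor
  · have h1 := h.index_sub y
    have h2 : orderOf (π y) = 2 := by
      rw [h.map_y, Prod.orderOf_mk, orderOf_one, orderOf_ofAdd_eq_addOrderOf, ZMod.addOrderOf_one,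
        Nat.lcm_one_left]
    rw [h2, mul_comm 2] at h1
    rw [degree_eq_index hρ hw0 hw inertia]
    exact Nat.eq_of_mul_eq_mul_right two_pos h1
  · intro k
    rw [finrank_dvd_iff hρ hw0 hw inertia, h.orderOf_dvd_mul_iff hs]
    constructor
    · rintro ⟨g, hg⟩
      obtain ⟨i, k', hk', hcase⟩ := h.eigenvalue_conj_cases (ker_le_sub y) hw0 hw g
      refine ⟨i, ?_⟩
      have h1 : χ (g⁻¹ * a * g) = χ a ^ r ^ i := by
        rcases hcase with ⟨-, h1, -⟩ | ⟨-, h1, -⟩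
        · exact h1
        · rw [h1, hαβ]
      rw [← hg a haT] at h1
      exact_mod_cast zmod_eq_of_pow_eq_pow h.prime hαp hα h1
    · rintro ⟨i, hi⟩
      exact ⟨x ^ i, fun t ht => h.eigenvalue_pow_eq_conj_x h.y_pow h.comm_xy hw0 hw (hq.pow)
        (by exact_mod_cast hi) ht⟩

/-- The factors on which `a` acts neither as `b` nor as its inverse. -/
theorem factor_of_ne (h : MetaPres p r s π a b x y) (hs : s = orderOf (r : ZMod p))
    (hq : Odd (Nat.card F)) (hρ : Function.Surjective ρ) (hd : d ≠ 0)
    (hab : ρ (MonoidAlgebra.of F G a) ≠ ρ (MonoidAlgebra.of F G b))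
    (hab' : ρ (MonoidAlgebra.of F G (a * b)) ≠ 1) :
    d = 2 * s ∧ ∀ k, finrank F D ∣ k ↔ orderOf (Nat.card F : ZMod p) ∣ k * s := by
  have haT := ker_le_sub 1 h.a_mem_ker
  have hbT := ker_le_sub 1 h.b_mem_ker
  obtain ⟨w, χ, hw0, hw⟩ := h.exists_eigenvector_ker (ρ := ρ) hd
  have hne := h.eigenvalue_ne (ker_le_sub 1) hρ hw0 hw hab
  have hmul := h.eigenvalue_mul_ne_one (ker_le_sub 1) hρ hw0 hw hab'
  have hαp := eigenvalue_pow_eq_one hw0 hw haT h.a_pow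
  have hβp := eigenvalue_pow_eq_one hw0 hw hbT h.b_pow
  -- One of the eigenvalues may be `1`, but not both, since they differ.
  have key : ∀ m n : ℕ, χ a ^ m = χ a ^ n → χ b ^ m = χ b ^ n → (m : ZMod p) = n := by
    intro m n h1 h2
    by_cases hα : χ a = 1
    · exact zmod_eq_of_pow_eq_pow h.prime hβp (fun hβ => hne (by rw [hα, hβ])) h2
    · exact zmod_eq_of_pow_eq_pow h.prime hαp hα h1
  -- Neither the stabiliser (`m = 1`) nor a Frobenius power (`m = q ^ k`) can involve the exchange
  -- of `a` and `b`.
  have swap : ∀ m i : ℕ, χ a ^ m = χ b ^ r ^ i → χ b ^ m = χ a ^ r ^ i → False := fun m i h1 h2 =>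
    (eq_or_mul_eq_one_of_pow_swap h.prime hαp hβp (h.zmod_ne_zero hs i) h1 h2).elim hne hmul
  have inertia : ∀ g, (∀ t ∈ sub π 1, χ (g⁻¹ * t * g) = χ t) → g ∈ sub π 1 := by
    intro g hg
    obtain ⟨i, k, hk, ⟨rfl, h1, h2⟩ | ⟨rfl, h1, h2⟩⟩ :=
      h.eigenvalue_conj_cases (ker_le_sub 1) hw0 hw g
    · rw [hg a haT] at h1
      rw [hg b hbT] at h2
      have := key (r ^ i) 1 (by rw [← h1, pow_one]) (by rw [← h2, pow_one])
      rw [h.x_pow_eq_one hs (by simpa using this), one_mul]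
      exact ker_le_sub 1 hk
    · rw [hg a haT] at h1
      rw [hg b hbT] at h2
      exact (swap 1 i (by rw [← h1, pow_one]) (by rw [← h2, pow_one])).elim
  refine ⟨by rw [degree_eq_index hρ hw0 hw inertia, h.index_sub_one], fun k => ?_⟩
  rw [finrank_dvd_iff hρ hw0 hw inertia, h.orderOf_dvd_mul_iff hs]
  constructor
  · rintro ⟨g, hg⟩
    obtain ⟨i, k', hk', ⟨-, h1, h2⟩ | ⟨-, h1, h2⟩⟩ :=
      h.eigenvalue_conj_cases (ker_le_sub 1) hw0 hw g
    · rw [← hg a haT] at h1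
      rw [← hg b hbT] at h2
      exact ⟨i, by exact_mod_cast key _ _ h1 h2⟩
    · rw [← hg a haT] at h1
      rw [← hg b hbT] at h2
      exact (swap _ i h1 h2).elim
  · rintro ⟨i, hi⟩
    exact ⟨x ^ i, fun t ht => h.eigenvalue_pow_eq_conj_x (one_pow 2) (Commute.one_right x) hw0 hw
      (hq.pow) (by exact_mod_cast hi) ht⟩

/-- The factors on which `a` acts nontrivially and as the inverse of `b`, for odd `s`. -/
theorem factor_of_mul_eq_one_of_odd (h : MetaPres p r s π a b x y)
    (hs : s = orderOf (r : ZMod p)) (hp : Odd p) (hsodd : Odd s)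
    (hq : Odd (Nat.card F)) (hρ : Function.Surjective ρ) (hd : d ≠ 0)
    (hab : ρ (MonoidAlgebra.of F G (a * b)) = 1) (ha : ρ (MonoidAlgebra.of F G a) ≠ 1) :
    d = 2 * s ∧ ∀ k, finrank F D ∣ k ↔ orderOf (Nat.card F : ZMod p) ∣ k * (2 * s) := by
  have : Fact p.Prime := ⟨h.prime⟩
  have haT := ker_le_sub 1 h.a_mem_ker
  have hbT := ker_le_sub 1 h.b_mem_ker
  obtain ⟨w, χ, hw0, hw⟩ := h.exists_eigenvector_ker (ρ := ρ) hd
  have hβ : χ b = (χ a)⁻¹ := by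
    rw [eq_comm, inv_eq_iff_eq_inv, ← eigenvalue_inv hw0 hw hbT]
    exact (eigenvalue_eq_of_map_eq hw0 hw (inv_mem hbT) haT
      (map_b_eq_of_mul_eq_one (groupHom ρ) hab)).symm
  have hα := h.eigenvalue_a_ne_one (ker_le_sub 1) hρ hw0 hw (fun e => by rw [hβ, e, inv_one]) ha
  have hαp := eigenvalue_pow_eq_one hw0 hw haT h.a_pow
  have : Fact (2 < p) := ⟨by
    rcases hp with ⟨m, hm⟩
    have := h.prime.two_le
    omega⟩
  have hneg : (1 : ZMod p) ≠ -1 := ZMod.neg_one_ne_one.symm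
  -- The order `s` of `r` is odd. Hence no `x ^ i * y` fixes the pair of inverse eigenvalues.
  have hneg_mem : ∀ i : ℕ, (r : ZMod p) ^ i ≠ -1 := by
    intro i hi
    have h1 : (r : ZMod p) ^ (i * s) = 1 := by
      rw [mul_comm, pow_mul, hs, pow_orderOf_eq_one, one_pow]
    rw [pow_mul, hi, hsodd.neg_one_pow] at h1
    exact hneg h1.symm
  have inertia : ∀ g, (∀ t ∈ sub π 1, χ (g⁻¹ * t * g) = χ t) → g ∈ sub π 1 := by
    intro g hg
    obtain ⟨i, k, hk, ⟨rfl, h1, h2⟩ | ⟨rfl, h1, h2⟩⟩ :=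
      h.eigenvalue_conj_cases (ker_le_sub 1) hw0 hw g
    · rw [hg a haT] at h1
      have := zmod_eq_of_pow_eq_pow (m := r ^ i) (n := 1) h.prime hαp hα (by rw [← h1, pow_one])
      rw [h.x_pow_eq_one hs (by simpa using this), one_mul]
      exact ker_le_sub 1 hk
    · rw [hg a haT, hβ] at h1
      have := zmod_eq_neg_of_pow_eq_inv_pow (m := 1) (n := r ^ i) h.prime hαp hα
        (by rw [← h1, pow_one])
      refine (hneg_mem i ?_).elim
      rw [← Nat.cast_pow, eq_neg_iff_add_eq_zero, add_comm, ← eq_neg_iff_add_eq_zero, ← this]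
      simp
  refine ⟨by rw [degree_eq_index hρ hw0 hw inertia, h.index_sub_one], fun k => ?_⟩
  rw [finrank_dvd_iff hρ hw0 hw inertia]
  constructor
  · rintro ⟨g, hg⟩
    -- Frobenius is matched by `x ^ i` if `q ^ k = r ^ i`, and by `x ^ i * y` if `q ^ k = -r ^ i`;
    -- squaring merges the cases and accounts for the factor `2` in `2 * s`.
    have hsq : ∃ i : ℕ, ((Nat.card F : ZMod p) ^ k) ^ 2 = ((r : ZMod p) ^ i) ^ 2 := by
      obtain ⟨i, k', hk', ⟨-, h1, -⟩ | ⟨-, h1, -⟩⟩ :=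
        h.eigenvalue_conj_cases (ker_le_sub 1) hw0 hw g
      · rw [← hg a haT] at h1
        have := zmod_eq_of_pow_eq_pow h.prime hαp hα h1
        push_cast at this
        exact ⟨i, by rw [this]⟩
      · rw [← hg a haT, hβ] at h1
        have := zmod_eq_neg_of_pow_eq_inv_pow h.prime hαp hα h1
        push_cast at this
        exact ⟨i, by rw [this, neg_sq]⟩
    obtain ⟨i, hi⟩ := hsq
    rw [orderOf_dvd_iff_pow_eq_one, pow_mul, pow_mul, hi, ← pow_mul, ← pow_mul, mul_comm 2,
      mul_comm, pow_mul, pow_mul, hs, pow_orderOf_eq_one, one_pow, one_pow]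
  · intro hk
    rw [orderOf_dvd_iff_pow_eq_one, pow_mul, mul_comm 2, pow_mul, sq_eq_one_iff] at hk
    rcases hk with hk | hk
    · obtain ⟨i, hi⟩ := (h.orderOf_dvd_mul_iff hs (Nat.card F : ZMod p) k).mp
        (by rw [orderOf_dvd_iff_pow_eq_one, pow_mul, hk])
      exact ⟨x ^ i, fun t ht => h.eigenvalue_pow_eq_conj_x (one_pow 2) (Commute.one_right x) hw0 hw
        (hq.pow) (by exact_mod_cast hi) ht⟩
    -- Here `q ^ (k * s) = -1`; as `s` is odd, `-q ^ k` is an `s`-th root of unity, hence a power of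
    -- `r`.
    · obtain ⟨i, hi⟩ := exists_eq_pow_of_pow_orderOf_eq_one h.prime
        (r := (r : ZMod p)) (v := -(Nat.card F : ZMod p) ^ k) (hs ▸ h.s_pos) (by
          rw [← hs, hsodd.neg_pow, hk, neg_neg])
      have hi' : ((Nat.card F ^ k : ℕ) : ZMod p) = -(r ^ i : ℕ) := by
        push_cast
        rw [← hi, neg_neg]
      refine ⟨x ^ i * y, fun t ht => eigenvalue_pow_eq_of_closure hw0 hw (h.sub_eq_closure 1) ?_ ht⟩
      rintro t (rfl | rfl | rfl)
      · simp [eigenvalue_one hw0 hw]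
      · rw [h.conj_xy_a, eigenvalue_pow hw0 hw hbT, hβ]
        exact pow_eq_inv_pow_of_zmod_eq_neg h.prime hαp hi'
      · rw [h.conj_xy_b, eigenvalue_pow hw0 hw haT, hβ]
        conv_rhs => rw [← inv_inv (χ a)]
        exact pow_eq_inv_pow_of_zmod_eq_neg h.prime (by rw [inv_pow, hαp, inv_one]) hi'

/-- The factors on which `a` acts nontrivially and as the inverse of `b`, for even `s`. -/
theorem factor_of_mul_eq_one_of_even (h : MetaPres p r s π a b x y)
    (hs : s = orderOf (r : ZMod p)) {m : ℕ} (hm : s = 2 * m)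
    (hq : Odd (Nat.card F)) (hρ : Function.Surjective ρ) (hd : d ≠ 0)
    (hab : ρ (MonoidAlgebra.of F G (a * b)) = 1) (ha : ρ (MonoidAlgebra.of F G a) ≠ 1) :
    d = s ∧ ∀ k, finrank F D ∣ k ↔ orderOf (Nat.card F : ZMod p) ∣ k * s := by
  have : Fact p.Prime := ⟨h.prime⟩
  have hm0 : 0 < m := by have := h.s_pos; omega
  have hrm : (r : ZMod p) ^ m = -1 := by
    have h1 : ((r : ZMod p) ^ m) ^ 2 = 1 := by
      rw [← pow_mul, mul_comm, ← hm, hs, pow_orderOf_eq_one]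
    refine (sq_eq_one_iff.mp h1).resolve_left fun e => ?_
    have := Nat.le_of_dvd hm0 (orderOf_dvd_of_pow_eq_one e)
    omega
  -- Since `r ^ m = -1`, conjugation by `z` sends `a` to `b⁻¹`, which acts as `a` does. Thus `z`
  -- plays the role that `y` has when `a` and `b` act equally.
  obtain ⟨z, hz⟩ : ∃ z, z = x ^ m * y := ⟨_, rfl⟩
  have hz2 : z ^ 2 = 1 := by
    rw [hz, (h.comm_xy.pow_left m).mul_pow, ← pow_mul, mul_comm m, ← hm, h.x_pow, h.y_pow, one_mul]
  have hxz : Commute x z := hz ▸ ((Commute.refl x).pow_right m).mul_right h.comm_xy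
  have haT := ker_le_sub z h.a_mem_ker
  have hbT := ker_le_sub z h.b_mem_ker
  have hρb : ρ (MonoidAlgebra.of F G b⁻¹) = ρ (MonoidAlgebra.of F G a) :=
    map_b_eq_of_mul_eq_one (groupHom ρ) hab
  have hbr : b ^ r ^ m = b⁻¹ := by
    rw [eq_comm, inv_eq_iff_mul_eq_one, ← pow_succ']
    obtain ⟨n, hn⟩ : p ∣ r ^ m + 1 := by
      rw [← ZMod.natCast_eq_zero_iff]
      push_cast
      rw [hrm, neg_add_cancel]
    rw [hn, pow_mul, h.b_pow, one_pow]
  have hza : Commute (ρ (MonoidAlgebra.of F G z)) (ρ (MonoidAlgebra.of F G a)) := by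
    have h1 : a * z = z * b⁻¹ := by
      rw [← hbr, ← h.conj_xy_a, ← hz]; group
    have h2 := congrArg (fun g => ρ (MonoidAlgebra.of F G g)) h1
    simp only [map_mul] at h2
    rw [hρb] at h2
    exact h2.symm
  have hcl : Subgroup.closure {z, a, b} = Subgroup.closure {z, a, b⁻¹} := by
    apply le_antisymm <;> rw [Subgroup.closure_le]
    · rintro t (rfl | rfl | rfl)
      · exact Subgroup.subset_closure (by simp)
      · exact Subgroup.subset_closure (by simp)
      · exact (Subgroup.inv_mem_iff _).mp (Subgroup.subset_closure (by simp))
    rintro _ (rfl | rfl | rfl)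
    · exact Subgroup.subset_closure (by simp)
    · exact Subgroup.subset_closure (by simp)
    · exact Subgroup.inv_mem _ (Subgroup.subset_closure (by simp))
  obtain ⟨w, χ, hw0, hw⟩ := exists_eigenvector_of_commute (Ω := AlgebraicClosure D) (ρ := ρ) hd
    (sub π z) (by
      rw [h.sub_eq_closure, hcl]
      intro t ht t' ht'
      refine commute_of_mem_closure (groupHom ρ) ?_ ht ht'
      have hzb := hza
      have hab' : Commute (ρ (MonoidAlgebra.of F G a)) (ρ (MonoidAlgebra.of F G b⁻¹)) := by
        rw [hρb]
      rw [← hρb] at hzb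
      rintro u (rfl | rfl | rfl) v (rfl | rfl | rfl)
      exacts [Commute.refl _, hza, hzb, hza.symm, Commute.refl _, hab', hzb.symm, hab'.symm,
        Commute.refl _])
  have hβ : χ b = (χ a)⁻¹ := by
    rw [eq_comm, inv_eq_iff_eq_inv, ← eigenvalue_inv hw0 hw hbT]
    exact (eigenvalue_eq_of_map_eq hw0 hw (inv_mem hbT) haT hρb).symm
  have hα := h.eigenvalue_a_ne_one (ker_le_sub z) hρ hw0 hw (fun e => by rw [hβ, e, inv_one]) ha
  have hαp := eigenvalue_pow_eq_one hw0 hw haT h.a_pow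
  have inertia : ∀ g, (∀ t ∈ sub π z, χ (g⁻¹ * t * g) = χ t) → g ∈ sub π z := by
    intro g hg
    obtain ⟨i, k, hk, ⟨rfl, h1, h2⟩ | ⟨rfl, h1, h2⟩⟩ :=
      h.eigenvalue_conj_cases (ker_le_sub z) hw0 hw g
    · rw [hg a haT] at h1
      have := zmod_eq_of_pow_eq_pow (m := r ^ i) (n := 1) h.prime hαp hα (by rw [← h1, pow_one])
      rw [h.x_pow_eq_one hs (by simpa using this), one_mul]
      exact ker_le_sub z hk
    · rw [hg a haT, hβ] at h1
      have h3 := zmod_eq_neg_of_pow_eq_inv_pow (m := 1) (n := r ^ i) h.prime hαp hα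
        (by rw [← h1, pow_one])
      push_cast at h3
      have h4 : x ^ (i + m) = 1 := h.x_pow_eq_one hs (by rw [pow_add, hrm, mul_neg_one, ← h3])
      have h5 : x ^ (2 * m) = 1 := by rw [← hm, h.x_pow]
      have h6 : x ^ i = x ^ m := by
        rw [← mul_left_inj (x ^ m), ← pow_add, h4, ← pow_add, ← two_mul, h5]
      rw [h6, ← hz]
      exact mul_mem (mem_sub_self z) (ker_le_sub z hk)
  constructor
  · have h1 := h.index_sub z
    have h2 : orderOf (π z) = 2 := by
      refine orderOf_eq_prime (by rw [← map_pow, hz2, map_one]) fun e => ?_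
      rw [hz, ← pow_one y, h.map_pow_mul_pow, Prod.mk_eq_one] at e
      exact absurd e.2 (by decide)
    rw [h2, mul_comm 2] at h1
    rw [degree_eq_index hρ hw0 hw inertia]
    exact Nat.eq_of_mul_eq_mul_right two_pos h1
  · intro k
    rw [finrank_dvd_iff hρ hw0 hw inertia, h.orderOf_dvd_mul_iff hs]
    constructor
    · rintro ⟨g, hg⟩
      obtain ⟨i, k', hk', ⟨-, h1, -⟩ | ⟨-, h1, -⟩⟩ :=
        h.eigenvalue_conj_cases (ker_le_sub z) hw0 hw g
      · rw [← hg a haT] at h1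
        exact ⟨i, by exact_mod_cast zmod_eq_of_pow_eq_pow h.prime hαp hα h1⟩
      · rw [← hg a haT, hβ] at h1
        have := zmod_eq_neg_of_pow_eq_inv_pow h.prime hαp hα h1
        push_cast at this
        exact ⟨i + m, by rw [this, pow_add, hrm, mul_neg_one]⟩
    · rintro ⟨i, hi⟩
      exact ⟨x ^ i, fun t ht => h.eigenvalue_pow_eq_conj_x hz2 hxz hw0 hw (hq.pow)
        (by exact_mod_cast hi) ht⟩

/-- The factors on which `a` and `b` act trivially. -/
theorem factor_of_trivial (h : MetaPres p r s π a b x y)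
    (hq : Odd (Nat.card F)) (hρ : Function.Surjective ρ) (hd : d ≠ 0)
    (ha : ρ (MonoidAlgebra.of F G a) = 1) (hb : ρ (MonoidAlgebra.of F G b) = 1) :
    d = 1 ∧ ∀ k, finrank F D ∣ k ↔
      orderOf (Nat.card F : ZMod (orderOf (ρ (MonoidAlgebra.of F G x)))) ∣ k := by
  have hxy : Commute (ρ (MonoidAlgebra.of F G x)) (ρ (MonoidAlgebra.of F G y)) :=
    h.comm_xy.map (groupHom ρ)
  obtain ⟨w, χ, hw0, hw⟩ := exists_eigenvector_of_commute (Ω := AlgebraicClosure D) (ρ := ρ) hd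
    ⊤ (by
      rw [← h.closure_eq_top]
      intro t ht t' ht'
      refine commute_of_mem_closure (groupHom ρ) ?_ ht ht'
      have ha' : ∀ m, Commute (ρ (MonoidAlgebra.of F G a)) m := fun m => ha ▸ Commute.one_left m
      have hb' : ∀ m, Commute (ρ (MonoidAlgebra.of F G b)) m := fun m => hb ▸ Commute.one_left m
      rintro u (rfl | rfl | rfl | rfl) v (rfl | rfl | rfl | rfl)
      exacts [ha' _, ha' _, ha' _, ha' _, hb' _, hb' _, hb' _, hb' _, (ha' _).symm, (hb' _).symm,
        Commute.refl _, hxy, (ha' _).symm, (hb' _).symm, hxy.symm, Commute.refl _])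
  have mem : ∀ g : G, g ∈ (⊤ : Subgroup G) := Subgroup.mem_top
  have hχ1 : ∀ t, ρ (MonoidAlgebra.of F G t) = 1 → χ t = 1 := fun t ht => by
    rw [← eigenvalue_one hw0 hw]
    exact eigenvalue_eq_of_map_eq hw0 hw (mem _) (mem _) (by rw [ht, map_one, map_one])
  have hconj : ∀ g t, χ (g⁻¹ * t * g) = χ t := fun g t => by
    simpa using eigenvalue_conj_mul hw0 hw 1 (mem g) (mem t)
  have inertia : ∀ g, (∀ t ∈ (⊤ : Subgroup G), χ (g⁻¹ * t * g) = χ t) → g ∈ (⊤ : Subgroup G) :=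
    fun g _ => mem g
  -- If `x ^ n` fixes `w`, then so does the normal subgroup `⟨x ^ n, a, b⟩`, which therefore acts
  -- trivially.
  have hord : orderOf (ρ (MonoidAlgebra.of F G x)) = orderOf (χ x) := by
    rw [orderOf_eq_orderOf_iff]
    intro n
    rw [← map_pow, ← map_pow, ← eigenvalue_pow hw0 hw (mem x)]
    refine ⟨hχ1 _, fun hn => ?_⟩
    refine map_eq_one_of_fixed_closure (Ω := AlgebraicClosure D) hρ (sub π (x ^ n))
      (h.sub_eq_closure _) hw0 ?_ (mem_sub_self _)
    rintro _ (rfl | rfl | rfl)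
    · rw [hw _ (mem _), hn, one_smul]
    · rw [hw _ (mem _), hχ1 _ ha, one_smul]
    · rw [hw _ (mem _), hχ1 _ hb, one_smul]
  have hfin : IsOfFinOrder (χ x) := isOfFinOrder_iff_pow_eq_one.mpr
    ⟨s, h.s_pos, eigenvalue_pow_eq_one hw0 hw (mem x) h.x_pow⟩
  refine ⟨by rw [degree_eq_index hρ hw0 hw inertia, Subgroup.index_top], fun k => ?_⟩
  have h1 : orderOf (Nat.card F : ZMod (orderOf (χ x))) ∣ k ↔ χ x ^ Nat.card F ^ k = χ x := by
    rw [orderOf_dvd_iff_pow_eq_one]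
    conv_rhs => rhs; rw [← pow_one (χ x)]
    rw [hfin.pow_eq_pow_iff_modEq, ← ZMod.natCast_eq_natCast_iff]
    push_cast
    rfl
  rw [finrank_dvd_iff hρ hw0 hw inertia, hord, h1]
  constructor
  · rintro ⟨g, hg⟩
    rw [hg x (mem x), hconj]
  · intro hx
    refine ⟨1, fun t ht => eigenvalue_pow_eq_of_closure hw0 hw h.closure_eq_top.symm ?_ ht⟩
    intro t ht
    rw [hconj]
    rcases ht with rfl | rfl | rfl | rfl
    · rw [hχ1 _ ha, one_pow]
    · rw [hχ1 _ hb, one_pow]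
    · exact hx
    -- `χ y = ±1` is unchanged by odd powers, so only `χ x` governs the degree.
    · obtain ⟨m, hm⟩ := hq.pow (n := k)
      rw [hm, pow_succ, pow_mul, eigenvalue_pow_eq_one hw0 hw (mem _) h.y_pow, one_pow, one_mul]

end Factors

end MetaPres

/-! ### Products of algebras -/

section Products

variable {F : Type*} [Field F] {I : Type*} {X : I → Type*} [∀ i, Ring (X i)]
  [∀ i, Algebra F (X i)]

/-- Restriction of a family to a smaller index set. -/
def restrictAlgHom {A C : I → Prop} (hAC : ∀ i, A i → C i) :
    (Π i : {i // C i}, X i) →ₐ[F] (Π i : {i // A i}, X i) :=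
  AlgHom.pi fun i => Pi.evalAlgHom F (fun i : {i // C i} => X i) ⟨i.1, hAC _ i.2⟩

theorem nonempty_algEquiv_prod {A B C : I → Prop} (hC : ∀ i, C i ↔ A i ∨ B i)
    (hAB : ∀ i, A i → ¬ B i) :
    Nonempty ((Π i : {i // C i}, X i) ≃ₐ[F] (Π i : {i // A i}, X i) × (Π i : {i // B i}, X i)) := by
  classical
  refine ⟨AlgEquiv.ofBijective ((restrictAlgHom fun i hi => (hC i).mpr (Or.inl hi)).prod
    (restrictAlgHom fun i hi => (hC i).mpr (Or.inr hi))) ⟨fun u v huv => ?_, fun u => ?_⟩⟩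
  · have h1 := congrArg Prod.fst huv
    have h2 := congrArg Prod.snd huv
    funext ⟨i, hi⟩
    rcases (hC i).mp hi with hA | hB
    · exact congrFun h1 ⟨i, hA⟩
    · exact congrFun h2 ⟨i, hB⟩
  · refine ⟨fun i => if hA : A i then u.1 ⟨i, hA⟩ else
      u.2 ⟨i, ((hC i).mp i.2).resolve_left hA⟩, ?_⟩
    refine Prod.ext (funext fun i => ?_) (funext fun i => ?_)
    · exact dif_pos i.2
    · exact dif_neg fun hA => hAB i hA i.2

theorem nonempty_algEquiv_subtype {C : I → Prop} (hC : ∀ i, C i) :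
    Nonempty ((Π i, X i) ≃ₐ[F] (Π i : {i // C i}, X i)) :=
  ⟨AlgEquiv.ofBijective (AlgHom.pi fun i => Pi.evalAlgHom F X i)
    ⟨fun _ _ huv => funext fun i => congrFun huv ⟨i, hC i⟩, fun u => ⟨fun i => u ⟨i, hC i⟩, rfl⟩⟩⟩

theorem nonempty_algEquiv_fibers {J : Type*} (t : I → J) :
    Nonempty ((Π i, X i) ≃ₐ[F] (Π j, Π i : {i // t i = j}, X i)) := by
  refine ⟨AlgEquiv.ofBijective (AlgHom.pi fun j => AlgHom.pi fun i => Pi.evalAlgHom F X i)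
    ⟨fun u v huv => funext fun i => congrFun (congrFun huv (t i)) ⟨i, rfl⟩,
      fun u => ⟨fun i => u (t i) ⟨i, rfl⟩, ?_⟩⟩⟩
  funext j ⟨i, hi⟩
  subst hi
  rfl

theorem nonempty_algEquiv_fin_fun [Finite I] {Y : Type*} [Ring Y] [Algebra F Y] {k : ℕ}
    (hk : Nat.card I = k) (hX : ∀ i, Nonempty (X i ≃ₐ[F] Y)) :
    Nonempty ((Π i, X i) ≃ₐ[F] (Fin k → Y)) :=
  ⟨(AlgEquiv.piCongrRight fun i => (hX i).some).trans
    (AlgEquiv.piCongrLeft' F (fun _ : I => Y) (Finite.equivFinOfCardEq hk))⟩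

theorem nonempty_algEquiv_fin_add (Y : Type*) [Ring Y] [Algebra F Y] (k l : ℕ) :
    Nonempty (((Fin k → Y) × (Fin l → Y)) ≃ₐ[F] (Fin (k + l) → Y)) := by
  refine ⟨(AlgEquiv.ofBijective ((AlgHom.pi fun i => Pi.evalAlgHom F (fun _ => Y)
    (Fin.castAdd l i)).prod (AlgHom.pi fun i => Pi.evalAlgHom F (fun _ => Y)
    (Fin.natAdd k i))) ⟨fun u v huv => ?_, fun u => ?_⟩).symm⟩
  · funext i
    refine Fin.addCases (fun i => ?_) (fun i => ?_) i
    · exact congrFun (congrArg Prod.fst huv) i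
    · exact congrFun (congrArg Prod.snd huv) i
  · refine ⟨Fin.append u.1 u.2, Prod.ext (funext fun i => ?_) (funext fun i => ?_)⟩
    · exact Fin.append_left _ _ i
    · exact Fin.append_right _ _ i

theorem nonempty_algEquiv_matrix_extField [Finite F] {D : Type*} [Field D] [Algebra F D]
    [FiniteDimensional F D] {d n m : ℕ} (hd : d = n) (hm : finrank F D = m) :
    Nonempty (Matrix (Fin d) (Fin d) D ≃ₐ[F] Matrix (Fin n) (Fin n) (ExtField F m)) := by
  subst hd
  exact ⟨(nonempty_algEquiv_extField m hm).some.mapMatrix⟩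

theorem nonempty_algEquiv_matrix_one_extField [Finite F] {D : Type*} [Field D] [Algebra F D]
    [FiniteDimensional F D] {d m : ℕ} (hd : d = 1) (hm : finrank F D = m) :
    Nonempty (Matrix (Fin d) (Fin d) D ≃ₐ[F] ExtField F m) := by
  subst hd
  refine ⟨(AlgEquiv.ofBijective (IsScalarTower.toAlgHom F D (Matrix (Fin 1) (Fin 1) D))
    ⟨(algebraMap D (Matrix (Fin 1) (Fin 1) D)).injective, fun M => ⟨M 0 0, ?_⟩⟩).symm.trans
    (nonempty_algEquiv_extField m hm).some⟩
  ext i j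
  rw [Subsingleton.elim i 0, Subsingleton.elim j 0]
  simp [Matrix.algebraMap_matrix_apply]

theorem sum_finrank_matrix {F : Type*} [Field F] {I : Type*} [Fintype I] {D : I → Type*}
    [∀ i, Field (D i)] [∀ i, Algebra F (D i)] {d : I → ℕ} (P : I → Prop) [DecidablePred P]
    {n m : ℕ} (hP : ∀ i, P i → d i = n ∧ finrank F (D i) = m) :
    ∑ i with P i, finrank F (Matrix (Fin (d i)) (Fin (d i)) (D i))
      = Nat.card {i // P i} * (n ^ 2 * m) := by
  have : ∀ i ∈ Finset.univ.filter P,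
      finrank F (Matrix (Fin (d i)) (Fin (d i)) (D i)) = n ^ 2 * m := by
    intro i hi
    obtain ⟨h1, h2⟩ := hP i (Finset.mem_filter.mp hi).2
    rw [Module.finrank_matrix, h1, h2, Fintype.card_fin, sq]
  rw [Finset.sum_congr rfl this, Finset.sum_const, smul_eq_mul, Nat.card_eq_fintype_card,
    Fintype.card_subtype]

end Products

/-! ### Arithmetic -/

theorem dvd_mul_iff_div_gcd_dvd {f : ℕ} (hf : 0 < f) (k s : ℕ) :
    f ∣ k * s ↔ f / Nat.gcd f s ∣ k := by
  have hg : 0 < Nat.gcd f s := Nat.gcd_pos_of_pos_left s hf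
  obtain ⟨f', hf'⟩ := Nat.gcd_dvd_left f s
  obtain ⟨s', hs'⟩ := Nat.gcd_dvd_right f s
  have hcop : Nat.Coprime (f / Nat.gcd f s) (s / Nat.gcd f s) := Nat.coprime_div_gcd_div_gcd hg
  have h1 : f / Nat.gcd f s = f' := Nat.div_eq_of_eq_mul_right hg hf'
  have h2 : s / Nat.gcd f s = s' := Nat.div_eq_of_eq_mul_right hg hs'
  rw [h1, h2] at hcop
  rw [h1]
  constructor
  · intro h
    have h3 : Nat.gcd f s * f' ∣ Nat.gcd f s * (k * s') := by
      rw [← hf', mul_left_comm, ← hs']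
      exact h
    exact hcop.dvd_of_dvd_mul_right (Nat.dvd_of_mul_dvd_mul_left hg h3)
  · intro h
    have h3 := Nat.mul_dvd_mul_left (Nat.gcd f s) (Dvd.dvd.mul_right h s')
    rwa [← hf', mul_left_comm, ← hs'] at h3

/-- Turns the divisibility criteria for `finrank F D` into its value. -/
theorem eq_of_forall_dvd_iff {m n : ℕ} (h : ∀ k, m ∣ k ↔ n ∣ k) : m = n :=
  Nat.dvd_antisymm ((h n).mpr dvd_rfl) ((h m).mp dvd_rfl)

/-- A function is determined by its divisor sums, and `∑ φ(d) = e` over `d ∣ e`. -/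
theorem eq_two_mul_totient_of_sum_divisors {s : ℕ} (hs : 0 < s) {c : ℕ → ℕ}
    (hc : ∀ e, e ∣ s → ∑ d ∈ e.divisors, c d = 2 * e) : ∀ e, e ∣ s → c e = 2 * Nat.totient e := by
  intro e
  induction e using Nat.strong_induction_on with
  | _ e ih =>
    intro he
    have h1 := hc e he
    have h2 := Nat.sum_totient e
    rw [← Nat.cons_self_properDivisors (Nat.pos_of_dvd_of_pos he hs).ne', Finset.sum_cons] at h1 h2
    have h3 : ∑ d ∈ e.properDivisors, c d = ∑ d ∈ e.properDivisors, 2 * Nat.totient d :=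
      Finset.sum_congr rfl fun d hd =>
        ih d (Nat.mem_properDivisors.mp hd).2 ((Nat.mem_properDivisors.mp hd).1.trans he)
    rw [h3, ← Finset.mul_sum] at h1
    omega

theorem cast_ne_zero_of_coprime_card {F : Type*} [Field F] [Finite F] {n : ℕ}
    (h : Nat.Coprime (Nat.card F) n) : (n : F) ≠ 0 := by
  intro h0
  have := Fintype.ofFinite F
  obtain ⟨u, v, huv⟩ := Nat.isCoprime_iff_coprime.mpr h
  have h1 := congrArg (Int.cast : ℤ → F) huv
  push_cast at h1
  rw [h0, Nat.card_eq_fintype_card, FiniteField.cast_card_eq_zero] at h1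
  simp at h1

/-! ### Counting the factors of each class and assembling the decomposition. -/

namespace MetaPres

variable {G : Type v} [Group G] {p r s : ℕ}
  {π : G →* Multiplicative (ZMod s) × Multiplicative (ZMod 2)} {a b x y : G}

theorem orderOf_map_x (h : MetaPres p r s π a b x y) : orderOf (π x) = s := by
  rw [h.map_x, Prod.orderOf_mk, orderOf_one, orderOf_ofAdd_eq_addOrderOf, ZMod.addOrderOf_one,
    Nat.lcm_one_right]

theorem index_sub_x_pow (h : MetaPres p r s π a b x y) {e : ℕ} (he : e ∣ s) :
    (sub π (x ^ e)).index = 2 * e := by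
  obtain ⟨e', rfl⟩ := he
  have hpos := h.s_pos
  have he0 : e ≠ 0 := by rintro rfl; simp at hpos
  have he'0 : 0 < e' := Nat.pos_of_ne_zero (by rintro rfl; simp at hpos)
  have h1 := h.index_sub (x ^ e)
  rw [map_pow, orderOf_pow_of_dvd he0 (h.orderOf_map_x.symm ▸ Dvd.intro e' rfl), h.orderOf_map_x,
    Nat.mul_div_cancel_left _ (Nat.pos_of_ne_zero he0), ← mul_assoc] at h1
  exact Nat.eq_of_mul_eq_mul_right he'0 h1

theorem orderOf_pos_of_coprime (h : MetaPres p r s π a b x y) {q : ℕ} (hq : Nat.Coprime q p) :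
    0 < orderOf (q : ZMod p) ∧ orderOf (q : ZMod p) ∣ p - 1 := by
  have : Fact p.Prime := ⟨h.prime⟩
  have h0 : (q : ZMod p) ≠ 0 := by
    intro e
    rw [ZMod.natCast_eq_zero_iff] at e
    exact h.prime.one_lt.ne' (Nat.eq_one_of_dvd_coprimes hq e dvd_rfl)
  have h1 := ZMod.pow_card_sub_one_eq_one h0
  exact ⟨orderOf_pos_iff.mpr (isOfFinOrder_iff_pow_eq_one.mpr
    ⟨p - 1, by have := h.prime.two_le; omega, h1⟩), orderOf_dvd_of_pow_eq_one h1⟩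

/-! The four classes of representations, according to the action of `a` and `b`. -/

section Classes

variable {M : Type*} [Monoid M] (φ : G →* M)

/-- Both `a` and `b` act trivially. -/
def TrivialClass (a b : G) : Prop := φ a = 1 ∧ φ b = 1

/-- The elements `a` and `b` act by the same nontrivial operator. -/
def EqualClass (a b : G) : Prop := φ a = φ b ∧ φ a ≠ 1

/-- The elements `a` and `b` act by inverse nontrivial operators. -/
def InverseClass (a b : G) : Prop := φ (a * b) = 1 ∧ φ a ≠ 1

/-- The element `a` acts neither as `b` nor as its inverse. -/
def GenericClass (a b : G) : Prop := φ a ≠ φ b ∧ φ (a * b) ≠ 1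

variable {φ}

theorem map_mul_inv_eq_one_iff : φ (a * b⁻¹) = 1 ↔ TrivialClass φ a b ∨ EqualClass φ a b := by
  have h1 : φ (a * b⁻¹) = 1 ↔ φ a = φ b := by
    have e1 : φ a = φ (a * b⁻¹) * φ b := by rw [← map_mul, inv_mul_cancel_right]
    constructor
    · intro h2
      rw [e1, h2, one_mul]
    · intro h2
      rw [map_mul, h2, ← map_mul, mul_inv_cancel, map_one]
  rw [h1]
  constructor
  · intro h2
    by_cases h3 : φ a = 1
    · exact Or.inl ⟨h3, h2 ▸ h3⟩
    · exact Or.inr ⟨h2, h3⟩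
  · rintro (⟨h3, h4⟩ | ⟨h3, -⟩)
    · rw [h3, h4]
    · exact h3

theorem map_mul_eq_one_iff : φ (a * b) = 1 ↔ TrivialClass φ a b ∨ InverseClass φ a b := by
  constructor
  · intro h2
    by_cases h3 : φ a = 1
    · rw [map_mul, h3, one_mul] at h2
      exact Or.inl ⟨h3, h2⟩
    · exact Or.inr ⟨h2, h3⟩
  · rintro (⟨h3, h4⟩ | ⟨h3, -⟩)
    · rw [map_mul, h3, h4, one_mul]
    · exact h3

theorem class_exhaustive :
    TrivialClass φ a b ∨ EqualClass φ a b ∨ InverseClass φ a b ∨ GenericClass φ a b := by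
  by_cases h1 : φ a = φ b
  · by_cases h2 : φ a = 1
    · exact Or.inl ⟨h2, h1 ▸ h2⟩
    · exact Or.inr (Or.inl ⟨h1, h2⟩)
  · by_cases h2 : φ (a * b) = 1
    · rcases map_mul_eq_one_iff.mp h2 with h3 | h3
      · exact Or.inl h3
      · exact Or.inr (Or.inr (Or.inl h3))
    · exact Or.inr (Or.inr (Or.inr ⟨h1, h2⟩))

theorem TrivialClass.disjoint (h1 : TrivialClass φ a b) :
    ¬ (EqualClass φ a b ∨ InverseClass φ a b ∨ GenericClass φ a b) := by
  rintro (h2 | h2 | h2)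
  · exact h2.2 h1.1
  · exact h2.2 h1.1
  · exact h2.1 (by rw [h1.1, h1.2])

/-- Acting both as `b` and as its inverse forces `φ a ^ 2 = 1`, which with `φ a ^ p = 1` and `p` odd
gives `φ a = 1`. -/
theorem EqualClass.disjoint (hp : Odd p) (ha : a ^ p = 1) (h1 : EqualClass φ a b) :
    ¬ (InverseClass φ a b ∨ GenericClass φ a b) := by
  rintro (h2 | h2)
  · apply h1.2
    have h4 : φ a ^ 2 = 1 := by
      rw [sq]
      nth_rewrite 2 [h1.1]
      rw [← map_mul, h2.1]
    have h5 : φ a ^ p = 1 := by rw [← map_pow, ha, map_one]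
    obtain ⟨m, hm⟩ := hp
    rwa [hm, pow_succ, pow_mul, h4, one_pow, one_mul] at h5
  · exact h2.1 h1.1

theorem InverseClass.disjoint (h1 : InverseClass φ a b) : ¬ GenericClass φ a b :=
  fun h2 => h2.2 h1.1

end Classes

open Classical in
/-- The total weights of the classes are determined by the weights of the families on which normal
subgroups act trivially. -/
theorem sum_classes (h : MetaPres p r s π a b x y) (hp : Odd p) {I : Type*} [Fintype I]
    {M : I → Type*} [∀ i, Monoid (M i)] (R : ∀ i, G →* M i) (dim : I → ℕ)
    (count : ∀ (N : Subgroup G) [N.Normal] (S : Set G), N = Subgroup.closure S →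
      ∑ i with ∀ t ∈ S, R i t = 1, dim i = N.index) :
    ∑ i with EqualClass (R i) a b, dim i = 2 * s * (p - 1) ∧
    ∑ i with InverseClass (R i) a b, dim i = 2 * s * (p - 1) ∧
    ∑ i with GenericClass (R i) a b, dim i = 2 * s * (p - 1) ^ 2 ∧
    ∀ m, m ∣ s → ∑ i with TrivialClass (R i) a b ∧ orderOf (R i x) ∣ m, dim i = 2 * m := by
  have count' : ∀ (N : Subgroup G) [N.Normal] (S : Set G) (P : I → Prop) [DecidablePred P],
      N = Subgroup.closure S → (∀ i, P i ↔ ∀ t ∈ S, R i t = 1) →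
      ∑ i with P i, dim i = N.index := fun N _ S P _ hNS hP => by
    rw [← count N S hNS]
    exact Finset.sum_congr (Finset.filter_congr fun i _ => hP i) fun _ _ => rfl
  have sum_or : ∀ (A B C : I → Prop) [DecidablePred A] [DecidablePred B] [DecidablePred C],
      (∀ i, C i ↔ A i ∨ B i) → (∀ i, A i → ¬ B i) →
      ∑ i with C i, dim i = ∑ i with A i, dim i + ∑ i with B i, dim i := by
    intro A B C _ _ _ hC hAB
    rw [← Finset.sum_union (Finset.disjoint_filter.mpr fun i _ => hAB i)]
    refine Finset.sum_congr ?_ fun _ _ => rfl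
    ext i
    simp [hC]
  have := h.normal_zpowers_mul
  have := h.normal_zpowers_mul_inv
  -- The kernel, `⟨ab⁻¹⟩`, `⟨ab⟩` and the trivial subgroup act trivially on unions of classes;
  -- subtracting the resulting totals isolates each class.
  have S0 : ∑ i with TrivialClass (R i) a b, dim i = 2 * s :=
    (count' π.ker {a, b} _ h.ker_eq_closure (by simp [TrivialClass])).trans h.index_ker
  have S01 : ∑ i with TrivialClass (R i) a b ∨ EqualClass (R i) a b, dim i = 2 * s * p :=
    (count' _ {a * b⁻¹} (fun i => TrivialClass (R i) a b ∨ EqualClass (R i) a b)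
      (Subgroup.zpowers_eq_closure _) (fun i => by
      rw [← map_mul_inv_eq_one_iff]
      simp only [Set.mem_singleton_iff, forall_eq])).trans
      (h.index_zpowers h.mul_inv_pow_eq_one h.mul_inv_ne_one)
  have S02 : ∑ i with TrivialClass (R i) a b ∨ InverseClass (R i) a b, dim i = 2 * s * p :=
    (count' _ {a * b} (fun i => TrivialClass (R i) a b ∨ InverseClass (R i) a b)
      (Subgroup.zpowers_eq_closure _) (fun i => by
      rw [← map_mul_eq_one_iff]
      simp only [Set.mem_singleton_iff, forall_eq])).trans
      (h.index_zpowers h.mul_pow_eq_one h.mul_ne_one)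
  have Sall : ∑ i with TrivialClass (R i) a b ∨ EqualClass (R i) a b ∨ InverseClass (R i) a b ∨
      GenericClass (R i) a b, dim i = 2 * s * p ^ 2 :=
    (count' ⊥ ∅ (fun i => TrivialClass (R i) a b ∨ EqualClass (R i) a b ∨ InverseClass (R i) a b ∨
      GenericClass (R i) a b) Subgroup.closure_empty.symm
      (fun i => by simp [class_exhaustive])).trans
      (by rw [Subgroup.index_bot, h.card])
  rw [sum_or _ _ _ (fun i => Iff.rfl) fun i => TrivialClass.disjoint (φ := R i),
    sum_or _ _ _ (fun i => Iff.rfl) fun i => EqualClass.disjoint (φ := R i) hp h.a_pow,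
    sum_or _ _ _ (fun i => Iff.rfl) fun i => InverseClass.disjoint (φ := R i), S0] at Sall
  rw [sum_or _ _ _ (fun i => Iff.rfl) fun i (h1 : TrivialClass (R i) a b) h2 =>
    h1.disjoint (Or.inl h2), S0] at S01
  rw [sum_or _ _ _ (fun i => Iff.rfl) fun i (h1 : TrivialClass (R i) a b) h2 =>
    h1.disjoint (Or.inr (Or.inl h2)), S0] at S02
  have hx : ∀ m, m ∣ s →
      ∑ i with TrivialClass (R i) a b ∧ orderOf (R i x) ∣ m, dim i = 2 * m := fun m hm =>
    (count' (sub π (x ^ m)) {x ^ m, a, b}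
      (fun i => TrivialClass (R i) a b ∧ orderOf (R i x) ∣ m) (h.sub_eq_closure _) (fun i => by
      simp only [TrivialClass, Set.mem_insert_iff, Set.mem_singleton_iff, forall_eq_or_imp,
        forall_eq, map_pow, orderOf_dvd_iff_pow_eq_one]
      tauto)).trans (h.index_sub_x_pow hm)
  obtain ⟨p', hp'⟩ : ∃ p', p = p' + 1 := ⟨p - 1, (Nat.sub_add_cancel h.prime.pos).symm⟩
  have hsub : p - 1 = p' := by omega
  rw [hsub]
  rw [hp'] at S01 S02 Sall
  have S1 : ∑ i with EqualClass (R i) a b, dim i = 2 * s * p' := by linarith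
  have S2 : ∑ i with InverseClass (R i) a b, dim i = 2 * s * p' := by linarith
  refine ⟨S1, S2, ?_, hx⟩
  rw [S1, S2] at Sall
  linarith

open Classical in
/-- The number of commutative factors. -/
theorem card_trivialClass {F : Type*} [Field F] {I : Type*} [Fintype I] {D : I → Type*}
    [∀ i, Field (D i)] [∀ i, Algebra F (D i)] {d : I → ℕ} {q : ℕ} (hs : 0 < s)
    (R : ∀ i, G →* Matrix (Fin (d i)) (Fin (d i)) (D i))
    (hsum : ∀ m, m ∣ s → ∑ i with TrivialClass (R i) a b ∧ orderOf (R i x) ∣ m,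
      finrank F (Matrix (Fin (d i)) (Fin (d i)) (D i)) = 2 * m)
    (hshape : ∀ i, TrivialClass (R i) a b →
      d i = 1 ∧ finrank F (D i) = ordMod (orderOf (R i x)) q) :
    ∀ m, m ∣ s → Nat.card {i // TrivialClass (R i) a b ∧ orderOf (R i x) = m} * ordMod m q
      = 2 * Nat.totient m := by
  refine eq_two_mul_totient_of_sum_divisors hs fun m hm => ?_
  have hm0 : m ≠ 0 := (Nat.pos_of_dvd_of_pos hm hs).ne'
  have h2 : ∀ j, Nat.card {i // TrivialClass (R i) a b ∧ orderOf (R i x) = j} * ordMod j q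
      = ∑ i with TrivialClass (R i) a b ∧ orderOf (R i x) = j,
        finrank F (Matrix (Fin (d i)) (Fin (d i)) (D i)) := by
    intro j
    rw [sum_finrank_matrix (F := F) (D := D) (d := d)
      (fun i => TrivialClass (R i) a b ∧ orderOf (R i x) = j) (n := 1) (m := ordMod j q)
      (fun i hi => hi.2 ▸ hshape i hi.1), one_pow, one_mul]
  rw [← hsum m hm, Finset.sum_congr rfl fun j _ => h2 j,
    ← Finset.sum_fiberwise_of_maps_to (t := m.divisors) (g := fun i => orderOf (R i x))]
  · refine Finset.sum_congr rfl fun j hj => Finset.sum_congr ?_ fun _ _ => rfl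
    ext i
    simp only [Finset.mem_filter, Finset.mem_univ, true_and]
    constructor
    · rintro ⟨h3, rfl⟩
      exact ⟨⟨h3, Nat.dvd_of_mem_divisors hj⟩, rfl⟩
    · rintro ⟨⟨h3, -⟩, h4⟩
      exact ⟨h3, h4⟩
  · intro i hi
    exact Nat.mem_divisors.mpr ⟨(Finset.mem_filter.mp hi).2.2, hm0⟩

/-- The product of the commutative factors. -/
theorem nonempty_algEquiv_commSum {F : Type*} [Field F] [Finite F] {I : Type*} [Finite I]
    {D : I → Type*} [∀ i, Field (D i)] [∀ i, Algebra F (D i)] [∀ i, FiniteDimensional F (D i)]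
    {d : I → ℕ} {q : ℕ} (P : I → Prop) (t : I → ℕ) (ht : ∀ i, t i ∈ s.divisors)
    (hshape : ∀ i, P i → d i = 1 ∧ finrank F (D i) = ordMod (t i) q)
    (hcard : ∀ m, m ∣ s → Nat.card {i // P i ∧ t i = m} * ordMod m q = 2 * Nat.totient m) :
    Nonempty ((Π i : {i // P i}, Matrix (Fin (d i)) (Fin (d i)) (D i)) ≃ₐ[F] CommSum F s q) := by
  obtain ⟨g0⟩ := nonempty_algEquiv_fibers (F := F)
    (X := fun i : {i // P i} => Matrix (Fin (d i)) (Fin (d i)) (D i))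
    (fun i => (⟨t i, ht i⟩ : s.divisors))
  have g1 : ∀ m : s.divisors, Nonempty
      ((Π i : {i : {i // P i} // (⟨t i, ht i⟩ : s.divisors) = m},
        Matrix (Fin (d i.1)) (Fin (d i.1)) (D i.1)) ≃ₐ[F]
        (Fin (2 * Nat.totient m / ordMod m q) → ExtField F (ordMod m q))) := by
    intro m
    refine nonempty_algEquiv_fin_fun ?_ fun i => ?_
    · have h1 := hcard m (Nat.dvd_of_mem_divisors m.2)
      have h2 : 0 < ordMod m q := by
        refine Nat.pos_of_ne_zero fun h0 => ?_
        rw [h0, mul_zero] at h1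
        have := Nat.totient_pos.mpr (Nat.pos_of_mem_divisors m.2)
        omega
      rw [← h1, Nat.mul_div_cancel _ h2]
      exact Nat.card_congr ⟨fun i => ⟨i.1.1, i.1.2, congrArg Subtype.val i.2⟩,
        fun i => ⟨⟨i.1, i.2.1⟩, Subtype.ext i.2.2⟩, fun _ => rfl, fun _ => rfl⟩
    · have h1 : t i.1 = m := congrArg Subtype.val i.2
      exact nonempty_algEquiv_matrix_one_extField (hshape i.1 i.1.2).1 (h1 ▸ (hshape i.1 i.1.2).2)
  exact ⟨g0.trans (AlgEquiv.piCongrRight fun m => (g1 m).some)⟩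

-- Parity of `s` affects only the inverse class, whose matrix size `δ` and degree `μ` are therefore
-- parameters. Multiplicities appear through equations of total dimension, which later yield both
-- the divisibilities and the exact quotients.
open Classical in
theorem decomposition {F : Type u} [Field F] [Finite F] (h : MetaPres p r s π a b x y)
    (hs : s = orderOf (r : ZMod p)) (hp : Odd p) {q f δ μ : ℕ} (hqF : Nat.card F = q)
    (hq : Nat.Coprime q (Nat.card G)) (hf : f = orderOf (q : ZMod p))
    (hδ : (Odd s ∧ δ = 2 * s ∧ μ = f / Nat.gcd f (2 * s)) ∨
      (Even s ∧ δ = s ∧ μ = f / Nat.gcd f s)) :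
    (∀ d, d ∣ s → ordMod d q ∣ 2 * Nat.totient d) ∧ ∃ k₁ k₂ k₃ : ℕ,
      k₁ * (s ^ 2 * (f / Nat.gcd f s)) = 2 * s * (p - 1) ∧
      k₂ * (δ ^ 2 * μ) = 2 * s * (p - 1) ∧
      k₃ * ((2 * s) ^ 2 * (f / Nat.gcd f s)) = 2 * s * (p - 1) ^ 2 ∧
      Nonempty (MonoidAlgebra F G ≃ₐ[F] CommSum F s q × MatSum F s (f / Nat.gcd f s) k₁ ×
        MatSum F δ μ k₂ × MatSum F (2 * s) (f / Nat.gcd f s) k₃) := by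
  subst hqF
  have : Finite G := h.finite
  have hqodd : Odd (Nat.card F) := by
    rw [← Nat.coprime_two_right]
    exact hq.coprime_dvd_right (by rw [h.card, mul_assoc]; exact Dvd.intro _ rfl)
  have hf0 : 0 < f := hf ▸ (h.orderOf_pos_of_coprime (hq.coprime_dvd_right
    (by rw [h.card, sq, ← mul_assoc]; exact Dvd.intro_left _ rfl))).1
  obtain ⟨n, D, d, _, _, _, hd, ⟨e⟩⟩ :=
    exists_algEquiv_pi_matrix_field F G (cast_ne_zero_of_coprime_card hq)
  have hne : ∀ i, Nonempty (Fin (d i)) := fun i => ⟨⟨0, Nat.pos_of_ne_zero (hd i)⟩⟩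
  let ρ : ∀ i, MonoidAlgebra F G →ₐ[F] Matrix (Fin (d i)) (Fin (d i)) (D i) := fun i =>
    (Pi.evalAlgHom F (fun i => Matrix (Fin (d i)) (Fin (d i)) (D i)) i).comp e.toAlgHom
  have hρ : ∀ i, Function.Surjective (ρ i) := fun i =>
    (Function.surjective_eval i).comp e.surjective
  obtain ⟨R, hR⟩ : ∃ R : ∀ i, G →* Matrix (Fin (d i)) (Fin (d i)) (D i),
      ∀ i g, R i g = ρ i (MonoidAlgebra.of F G g) := ⟨fun i => groupHom (ρ i), fun _ _ => rfl⟩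
  obtain ⟨S1, S2, S3, S0⟩ := h.sum_classes hp R
    (fun i => finrank F (Matrix (Fin (d i)) (Fin (d i)) (D i))) (fun N _ S hNS =>
      sum_finrank_eq_index (cast_ne_zero_of_coprime_card (hq.coprime_dvd_right
        N.card_subgroup_dvd_card)) e _ fun i => by
          constructor
          · intro hS t ht
            have hle : Subgroup.closure S ≤ (R i).ker := (Subgroup.closure_le _).mpr hS
            exact (hR i t).symm.trans (hle (hNS ▸ ht))
          · intro ht t htS
            exact (hR i t).trans (ht t (hNS ▸ Subgroup.subset_closure htS)))
  have T1 : ∀ i, EqualClass (R i) a b → d i = s ∧ finrank F (D i) = f / Nat.gcd f s := by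
    rintro i ⟨h1, h2⟩
    rw [hR, hR] at h1
    rw [hR] at h2
    obtain ⟨h3, h4⟩ := h.factor_of_eq hs hqodd (hρ i) (hd i) h1 h2
    exact ⟨h3, eq_of_forall_dvd_iff fun k => by rw [h4, ← hf, dvd_mul_iff_div_gcd_dvd hf0]⟩
  have T3 : ∀ i, GenericClass (R i) a b → d i = 2 * s ∧ finrank F (D i) = f / Nat.gcd f s := by
    rintro i ⟨h1, h2⟩
    rw [hR, hR] at h1
    rw [hR] at h2
    obtain ⟨h3, h4⟩ := h.factor_of_ne hs hqodd (hρ i) (hd i) h1 h2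
    exact ⟨h3, eq_of_forall_dvd_iff fun k => by rw [h4, ← hf, dvd_mul_iff_div_gcd_dvd hf0]⟩
  have T2 : ∀ i, InverseClass (R i) a b → d i = δ ∧ finrank F (D i) = μ := by
    rintro i ⟨h1, h2⟩
    rw [hR] at h1 h2
    rcases hδ with ⟨hodd, rfl, rfl⟩ | ⟨heven, rfl, rfl⟩
    · obtain ⟨h3, h4⟩ := h.factor_of_mul_eq_one_of_odd hs hp hodd hqodd (hρ i) (hd i) h1 h2
      exact ⟨h3, eq_of_forall_dvd_iff fun k => by rw [h4, ← hf, dvd_mul_iff_div_gcd_dvd hf0]⟩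
    · obtain ⟨m, hm⟩ := even_iff_two_dvd.mp heven
      obtain ⟨h3, h4⟩ := h.factor_of_mul_eq_one_of_even hs hm hqodd (hρ i) (hd i) h1 h2
      exact ⟨h3, eq_of_forall_dvd_iff fun k => by rw [h4, ← hf, dvd_mul_iff_div_gcd_dvd hf0]⟩
  have T0 : ∀ i, TrivialClass (R i) a b →
      d i = 1 ∧ finrank F (D i) = ordMod (orderOf (R i x)) (Nat.card F) := by
    rintro i ⟨h1, h2⟩
    rw [hR] at h1 h2
    obtain ⟨h3, h4⟩ := h.factor_of_trivial hqodd (hρ i) (hd i) h1 h2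
    rw [hR]
    exact ⟨h3, eq_of_forall_dvd_iff h4⟩
  have hord : ∀ i, orderOf (R i x) ∈ s.divisors := fun i =>
    Nat.mem_divisors.mpr ⟨orderOf_dvd_of_pow_eq_one (by rw [← map_pow, h.x_pow, map_one]),
      h.s_pos.ne'⟩
  have C0 := card_trivialClass h.s_pos R S0 T0
  refine ⟨fun m hm => Dvd.intro_left _ (C0 m hm), Nat.card {i // EqualClass (R i) a b},
    Nat.card {i // InverseClass (R i) a b}, Nat.card {i // GenericClass (R i) a b},
    (sum_finrank_matrix _ T1).symm.trans S1, (sum_finrank_matrix _ T2).symm.trans S2,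
    (sum_finrank_matrix _ T3).symm.trans S3, ?_⟩
  obtain ⟨e1⟩ := nonempty_algEquiv_subtype (F := F)
    (X := fun i => Matrix (Fin (d i)) (Fin (d i)) (D i))
    (fun i => class_exhaustive (φ := R i) (a := a) (b := b))
  obtain ⟨e2⟩ := nonempty_algEquiv_prod (F := F)
    (X := fun i => Matrix (Fin (d i)) (Fin (d i)) (D i)) (fun i => Iff.rfl)
    (fun i => TrivialClass.disjoint (φ := R i) (a := a) (b := b))
  obtain ⟨e3⟩ := nonempty_algEquiv_prod (F := F)
    (X := fun i => Matrix (Fin (d i)) (Fin (d i)) (D i)) (fun i => Iff.rfl)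
    (fun i => EqualClass.disjoint (φ := R i) (a := a) (b := b) hp h.a_pow)
  obtain ⟨e4⟩ := nonempty_algEquiv_prod (F := F)
    (X := fun i => Matrix (Fin (d i)) (Fin (d i)) (D i)) (fun i => Iff.rfl)
    (fun i => InverseClass.disjoint (φ := R i) (a := a) (b := b))
  obtain ⟨f0⟩ := nonempty_algEquiv_commSum (F := F) (D := D) _ (fun i => orderOf (R i x)) hord T0 C0
  obtain ⟨f1⟩ := nonempty_algEquiv_fin_fun (F := F) (I := {i // EqualClass (R i) a b}) rfl fun i =>
    nonempty_algEquiv_matrix_extField (T1 i i.2).1 (T1 i i.2).2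
  obtain ⟨f2⟩ := nonempty_algEquiv_fin_fun (F := F) (I := {i // InverseClass (R i) a b}) rfl
    fun i => nonempty_algEquiv_matrix_extField (T2 i i.2).1 (T2 i i.2).2
  obtain ⟨f3⟩ := nonempty_algEquiv_fin_fun (F := F) (I := {i // GenericClass (R i) a b}) rfl
    fun i => nonempty_algEquiv_matrix_extField (T3 i i.2).1 (T3 i i.2).2
  exact ⟨e.trans <| e1.trans <| e2.trans <| f0.prodCongr <| e3.trans <| f1.prodCongr <|
    e4.trans <| f2.prodCongr f3⟩

end MetaPres

/-! ### The parameters `g`, `g'` and the final formulas. -/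

/-- Commutativity of products of algebras. -/
def AlgEquiv.prodComm (F A B : Type*) [CommSemiring F] [Semiring A] [Semiring B] [Algebra F A]
    [Algebra F B] : (A × B) ≃ₐ[F] (B × A) :=
  { Equiv.prodComm A B with
    map_mul' := fun _ _ => rfl
    map_add' := fun _ _ => rfl
    commutes' := fun _ => rfl }

/-- Associativity of products of algebras. -/
def AlgEquiv.prodAssoc (F A B C : Type*) [CommSemiring F] [Semiring A] [Semiring B] [Semiring C]
    [Algebra F A] [Algebra F B] [Algebra F C] : ((A × B) × C) ≃ₐ[F] (A × B × C) :=
  { Equiv.prodAssoc A B C with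
    map_mul' := fun _ _ => rfl
    map_add' := fun _ _ => rfl
    commutes' := fun _ => rfl }

/-- The condition on `d` is that `s / d` divides `gcd(f, s)`. So every admissible `d` is a multiple
of `s / gcd(f, s)`, which is itself admissible. -/
theorem gPar_mul_gcd {s : ℕ} (hs : 0 < s) (f : ℕ) : gPar s f * Nat.gcd f s = s := by
  have hc : 0 < Nat.gcd f s := Nat.gcd_pos_of_pos_right f hs
  obtain ⟨t, ht⟩ : Nat.gcd f s ∣ s := Nat.gcd_dvd_right f s
  have ht0 : 0 < t := Nat.pos_of_ne_zero (by rintro rfl; omega)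
  suffices gPar s f = t by rw [this, mul_comm, ← ht]
  refine Nat.dvd_antisymm ?_ ?_
  · refine Finset.gcd_dvd (f := id) (b := t) ?_
    refine Finset.mem_filter.mpr ⟨Nat.mem_divisors.mpr ⟨⟨_, ht.trans (mul_comm _ _)⟩, hs.ne'⟩, ?_⟩
    have : s / t = Nat.gcd f s := Nat.div_eq_of_eq_mul_left ht0 ht
    exact this ▸ Nat.gcd_dvd_left f s
  · refine Finset.dvd_gcd fun d hd => ?_
    obtain ⟨hd1, hd2⟩ := Finset.mem_filter.mp hd
    obtain ⟨e, he⟩ := Nat.dvd_of_mem_divisors hd1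
    have hd0 : 0 < d := Nat.pos_of_mem_divisors hd1
    rw [he, Nat.mul_div_cancel_left _ hd0] at hd2
    have he0 : 0 < e := Nat.pos_of_ne_zero (by rintro rfl; omega)
    obtain ⟨k, hk⟩ : e ∣ Nat.gcd f s := Nat.dvd_gcd hd2 (he ▸ Dvd.intro_left d rfl)
    refine ⟨k, Nat.eq_of_mul_eq_mul_left he0 ?_⟩
    rw [id, mul_comm e d, ← he, ht, hk]
    ring

theorem mul_gPar {s : ℕ} (hs : 0 < s) (f : ℕ) : f * gPar s f = s * (f / Nat.gcd f s) := by
  have hc : 0 < Nat.gcd f s := Nat.gcd_pos_of_pos_right f hs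
  obtain ⟨t, ht⟩ : Nat.gcd f s ∣ f := Nat.gcd_dvd_left f s
  have h1 := gPar_mul_gcd hs f
  have h2 : f / Nat.gcd f s = t := Nat.div_eq_of_eq_mul_right hc ht
  rw [h2]
  calc f * gPar s f = Nat.gcd f s * t * gPar s f := by rw [← ht]
    _ = gPar s f * Nat.gcd f s * t := by ring
    _ = s * t := by rw [h1]

/-- Divisors of an odd `f` are odd, so the parity condition is automatic. -/
theorem gPar'_two_mul {m f : ℕ} (hf : Odd f) : gPar' (2 * m) f = gPar m f := by
  rw [gPar', gPar, Nat.mul_div_cancel_left _ two_pos]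
  congr 1
  refine Finset.filter_congr fun d _ => ?_
  rw [Nat.mul_div_mul_left _ _ two_pos]
  exact ⟨fun h => h.2, fun h => ⟨hf.of_dvd_nat h, h⟩⟩

theorem gcd_two_mul_of_odd_left {f : ℕ} (hf : Odd f) (m : ℕ) :
    Nat.gcd f (2 * m) = Nat.gcd f m :=
  Nat.Coprime.gcd_mul_left_cancel_right m (Nat.coprime_two_left.mpr hf)

/-- Source of the halved degree `fg/(2s)` for odd `s` and even `f`. -/
theorem div_gcd_eq_two_mul {f s : ℕ} (hf : Even f) (hs : Odd s) :
    f / Nat.gcd f s = 2 * (f / Nat.gcd f (2 * s)) := by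
  obtain ⟨m, rfl⟩ := even_iff_two_dvd.mp hf
  have hc : 0 < Nat.gcd m s := Nat.gcd_pos_of_pos_right m hs.pos
  rw [Nat.gcd_mul_left, Nat.mul_div_mul_left _ _ two_pos,
    Nat.Coprime.gcd_mul_left_cancel m (Nat.coprime_two_left.mpr hs),
    Nat.mul_div_assoc _ (Nat.gcd_dvd_left m s)]

/-- Powers of an odd `q` are `1` modulo `2`, so the factor `2` adds no condition. -/
theorem ordMod_two_mul {p q : ℕ} (hp : Odd p) (hq : Odd q) : ordMod p q = ordMod (2 * p) q := by
  refine eq_of_forall_dvd_iff fun k => ?_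
  have hk : q ^ k ≡ 1 [MOD 2] := Nat.odd_iff.mp hq.pow
  simp only [ordMod, orderOf_dvd_iff_pow_eq_one, ← Nat.cast_pow, ← Nat.cast_one (R := ZMod _),
    ZMod.natCast_eq_natCast_iff]
  rw [← Nat.modEq_and_modEq_iff_modEq_mul (Nat.coprime_two_left.mpr hp)]
  exact ⟨fun h => ⟨hk, h⟩, fun h => h.2⟩

/-- The divisibility conjuncts assert that the natural number quotients in the sums are exact. -/
theorem theorem2 {F : Type*} [Field F] [Finite F] (p r s q f g g' : ℕ)
    (hp : p.Prime) (hp_odd : Odd p)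
    (hr : 0 < r) (hrp : Nat.Coprime r p)
    (hs : s = ordMod p r) (hs_one : 1 < s)
    (hq : Nat.card F = q) (hqG : Nat.Coprime q (Nat.card (MetaGroup p r s)))
    (hf : f = ordMod p q) (hg : g = gPar s f) (hg' : g' = gPar' s f) :
    Nat.card (MetaGroup p r s) = 2 * s * p ^ 2 ∧
    f = ordMod (2 * p) q ∧
    (∀ d, d ∣ s → ordMod d q ∣ 2 * Nat.totient d) ∧
    (Odd s → Odd f →
      (s ∣ f * g ∧ f * g ∣ 2 * (p - 1) ∧ 2 * (f * g) ∣ p ^ 2 - p) ∧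
      Nonempty (MonoidAlgebra F (MetaGroup p r s) ≃ₐ[F]
        CommSum F s q ×
        MatSum F s (f * g / s) (2 * (p - 1) / (f * g)) ×
        MatSum F (2 * s) (f * g / s) ((p ^ 2 - p) / (2 * (f * g))))) ∧
    (Odd s → Even f →
      (s ∣ f * g ∧ f * g ∣ 2 * (p - 1) ∧ 2 * s ∣ f * g ∧ f * g ∣ p - 1 ∧
        2 * (f * g) ∣ (p - 1) ^ 2) ∧
      Nonempty (MonoidAlgebra F (MetaGroup p r s) ≃ₐ[F]
        CommSum F s q ×
        MatSum F s (f * g / s) (2 * (p - 1) / (f * g)) ×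
        MatSum F (2 * s) (f * g / (2 * s)) ((p - 1) / (f * g)) ×
        MatSum F (2 * s) (f * g / s) ((p - 1) ^ 2 / (2 * (f * g))))) ∧
    (Even s → Odd f →
      (s ∣ f * g ∧ f * g ∣ 2 * (p - 1) ∧ 2 * (f * g) ∣ (p - 1) ^ 2 ∧
        s ∣ 2 * (f * g') ∧ f * g' ∣ p - 1) ∧
      Nonempty (MonoidAlgebra F (MetaGroup p r s) ≃ₐ[F]
        CommSum F s q ×
        MatSum F s (f * g / s) (2 * (p - 1) / (f * g)) ×
        MatSum F (2 * s) (f * g / s) ((p - 1) ^ 2 / (2 * (f * g))) ×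
        MatSum F s (2 * (f * g') / s) ((p - 1) / (f * g')))) ∧
    (Even s → Even f →
      (s ∣ f * g ∧ f * g ∣ 4 * (p - 1) ∧ 2 * (f * g) ∣ (p - 1) ^ 2) ∧
      Nonempty (MonoidAlgebra F (MetaGroup p r s) ≃ₐ[F]
        CommSum F s q ×
        MatSum F s (f * g / s) (4 * (p - 1) / (f * g)) ×
        MatSum F (2 * s) (f * g / s) ((p - 1) ^ 2 / (2 * (f * g))))) := by
  have hs0 : 0 < s := by omega
  have h := metaPres_metaGroup hp hrp hs0 (by rw [hs]; exact pow_orderOf_eq_one _)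
  have hq2 : Odd q := by
    rw [← Nat.coprime_two_right]
    exact hqG.coprime_dvd_right (by rw [h.card, mul_assoc]; exact Dvd.intro _ rfl)
  have hqp : Nat.Coprime q p :=
    hqG.coprime_dvd_right (by rw [h.card, sq, ← mul_assoc]; exact Dvd.intro_left _ rfl)
  have hf0 : 0 < f := hf ▸ (h.orderOf_pos_of_coprime hqp).1
  have dec := fun δ μ => h.decomposition (δ := δ) (μ := μ) hs hp_odd hq hqG hf
  have hL : f * g = s * (f / Nat.gcd f s) := hg ▸ mul_gPar hs0 f
  have hf'0 : 0 < f / Nat.gcd f s :=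
    Nat.div_pos (Nat.gcd_le_left s hf0) (Nat.gcd_pos_of_pos_left s hf0)
  -- `f'` is the degree `fg/s` shared by the equal and generic classes.
  generalize hf' : f / Nat.gcd f s = f' at hL hf'0 dec
  have hL0 : 0 < s * f' := Nat.mul_pos hs0 hf'0
  have hLs : s * f' / s = f' := Nat.mul_div_cancel_left _ hs0
  have count₁ : ∀ k, k * (s ^ 2 * f') = 2 * s * (p - 1) → k * (s * f') = 2 * (p - 1) :=
    fun k hk => Nat.eq_of_mul_eq_mul_left hs0 (by linarith)
  have count₂ : ∀ k, k * ((2 * s) ^ 2 * f') = 2 * s * (p - 1) → k * (2 * (s * f')) = p - 1 :=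
    fun k hk => Nat.eq_of_mul_eq_mul_left (Nat.mul_pos two_pos hs0) (by linarith)
  have count₃ : ∀ k, k * ((2 * s) ^ 2 * f') = 2 * s * (p - 1) ^ 2 →
      k * (2 * (s * f')) = (p - 1) ^ 2 :=
    fun k hk => Nat.eq_of_mul_eq_mul_left (Nat.mul_pos two_pos hs0) (by linarith)
  have hdiv : ∀ {k m n : ℕ}, 0 < m → k * m = n → n / m = k :=
    fun hm e => e ▸ Nat.mul_div_cancel _ hm
  rw [hL, hLs]
  refine ⟨h.card, hf.trans (ordMod_two_mul hp_odd hq2), ?_, fun hso hfo => ?_, fun hso hfe => ?_,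
    fun hse hfo => ?_, fun hse hfe => ?_⟩
  · rcases Nat.even_or_odd s with hse | hso
    · exact (dec _ _ (Or.inr ⟨hse, rfl, rfl⟩)).1
    · exact (dec _ _ (Or.inl ⟨hso, rfl, rfl⟩)).1
  · obtain ⟨-, k₁, k₂, k₃, h₁, h₂, h₃, ⟨e⟩⟩ := dec (2 * s) f'
      (Or.inl ⟨hso, rfl, by rw [gcd_two_mul_of_odd_left hfo, hf']⟩)
    replace h₁ := count₁ _ h₁
    -- For odd `f` the inverse and generic classes have the same shape and merge: `(p - 1) + (p - 1)
    -- ^ 2 = p ^ 2 - p`.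
    have h₂₃ : (k₂ + k₃) * (2 * (s * f')) = p ^ 2 - p := by
      rw [add_mul, count₂ _ h₂, count₃ _ h₃]
      obtain ⟨p', rfl⟩ : ∃ p', p = p' + 1 := ⟨p - 1, (Nat.sub_add_cancel hp.pos).symm⟩
      rw [Nat.add_sub_cancel, eq_comm, Nat.sub_eq_iff_eq_add (Nat.le_self_pow two_ne_zero _)]
      ring
    rw [hdiv hL0 h₁, hdiv (Nat.mul_pos two_pos hL0) h₂₃]
    obtain ⟨e'⟩ := nonempty_algEquiv_fin_add (F := F)
      (Matrix (Fin (2 * s)) (Fin (2 * s)) (ExtField F f')) k₂ k₃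
    exact ⟨⟨Dvd.intro _ rfl, Dvd.intro_left _ h₁, Dvd.intro_left _ h₂₃⟩,
      ⟨e.trans <| AlgEquiv.refl.prodCongr <| AlgEquiv.refl.prodCongr e'⟩⟩
  · obtain ⟨-, k₁, k₂, k₃, h₁, h₂, h₃, ⟨e⟩⟩ := dec (2 * s) (f / Nat.gcd f (2 * s))
      (Or.inl ⟨hso, rfl, rfl⟩)
    have hμ := div_gcd_eq_two_mul hfe hso
    rw [hf'] at hμ
    generalize f / Nat.gcd f (2 * s) = μ at hμ h₂ e
    replace h₁ := count₁ _ h₁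
    replace h₃ := count₃ _ h₃
    replace h₂ : k₂ * (s * f') = p - 1 :=
      Nat.eq_of_mul_eq_mul_left (Nat.mul_pos two_pos hs0) (by rw [hμ]; linarith)
    have hL2 : s * f' = 2 * s * μ := by rw [hμ]; ring
    have hμL : s * f' / (2 * s) = μ := by
      rw [hL2, Nat.mul_div_cancel_left _ (Nat.mul_pos two_pos hs0)]
    rw [hdiv hL0 h₁, hdiv hL0 h₂, hdiv (Nat.mul_pos two_pos hL0) h₃, hμL]
    exact ⟨⟨Dvd.intro _ rfl, Dvd.intro_left _ h₁, Dvd.intro _ hL2.symm, Dvd.intro_left _ h₂,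
      Dvd.intro_left _ h₃⟩, ⟨e⟩⟩
  · obtain ⟨-, k₁, k₂, k₃, h₁, h₂, h₃, ⟨e⟩⟩ := dec s f' (Or.inr ⟨hse, rfl, rfl⟩)
    replace h₁ := count₁ _ h₁
    replace h₂ := count₁ _ h₂
    replace h₃ := count₃ _ h₃
    -- So `2fg'/s = fg/s`: the inverse class has the shape of the equal class, written in terms of
    -- `g'`.
    have hL' : 2 * (f * g') = s * f' := by
      obtain ⟨m, rfl⟩ := even_iff_two_dvd.mp hse
      rw [hg', gPar'_two_mul hfo, mul_gPar (by omega), ← gcd_two_mul_of_odd_left hfo, hf']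
      ring
    replace h₂ : k₂ * (f * g') = p - 1 := by
      rw [← hL'] at h₂
      linarith
    rw [hL', hLs, hdiv hL0 h₁, hdiv (by omega) h₂, hdiv (Nat.mul_pos two_pos hL0) h₃]
    exact ⟨⟨Dvd.intro _ rfl, Dvd.intro_left _ h₁, Dvd.intro_left _ h₃, Dvd.intro _ rfl,
      Dvd.intro_left _ h₂⟩, ⟨e.trans <| AlgEquiv.refl.prodCongr <| AlgEquiv.refl.prodCongr <|
        AlgEquiv.prodComm F _ _⟩⟩
  · obtain ⟨-, k₁, k₂, k₃, h₁, h₂, h₃, ⟨e⟩⟩ := dec s f' (Or.inr ⟨hse, rfl, rfl⟩)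
    replace h₃ := count₃ _ h₃
    -- The equal and inverse classes have the same shape and contribute `2(p - 1)` each.
    have h₁₂ : (k₁ + k₂) * (s * f') = 4 * (p - 1) := by
      rw [add_mul, count₁ _ h₁, count₁ _ h₂]
      ring
    rw [hdiv hL0 h₁₂, hdiv (Nat.mul_pos two_pos hL0) h₃]
    obtain ⟨e'⟩ := nonempty_algEquiv_fin_add (F := F)
      (Matrix (Fin s) (Fin s) (ExtField F f')) k₁ k₂
    exact ⟨⟨Dvd.intro _ rfl, Dvd.intro_left _ h₁₂, Dvd.intro_left _ h₃⟩,
      ⟨e.trans <| AlgEquiv.refl.prodCongr <|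
        (AlgEquiv.prodAssoc F _ _ _).symm.trans <| e'.prodCongr AlgEquiv.refl⟩⟩
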